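/- All graphs are finite and simple. For a graph $G$, let $\lambda(G)$ be its spectral radius, i.e. the maximum modulus of an eigenvalue of the adjacency matrix of $G$. For $r\ge 2$ and $t\ge 2$, let $K_r^+[t]$ be the graph obtained from the complete $r$-partite graph with $t$ vertices in each part by adding one edge inside one of the parts; a graph is $K_r^+[t]$-free if it has no (not necessarily induced) subgraph isomorphic to $K_r^+[t]$. **Theorem.** For all integers $t\ge 2$ and $r\ge 2$ there are $\varepsilon=\varepsilon_{t,r}>0$ and $n_0=n_{t,r}$ such that the following holds. Let $G$ be a $K_r^+[t]$-free graph with $m$ edges, and let $H$ be a complete $r$-partite graph with $V(H)\subseteq V(G)$, each of whose parts has at least $n_0$ vertices, and which is regular if $r\ge 3$. Suppose that $|E(G)\,\triangle\, E(H)|\le \varepsilon m$. Then $$\lambda^2(G)\le \Bigl(1-\frac1r\Bigr)\cdot 2m .$$ Moreover, up to isolated vertices of $G$, equality holds if and only if $G$ is a complete bipartite graph (when $r=2$), respectively a regular complete $r$-partite graph (when $r\ge 3$). -/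

import Mathlib

namespace EdgeSpectral

/-- The spectral radius of a finite graph: the maximum modulus of the eigenvalues of its
adjacency matrix. (The matrix is real symmetric, so all its eigenvalues are real.) -/
noncomputable def lam {V : Type*} [Fintype V] (G : SimpleGraph V) : ℝ :=
  open Classical in (spectralRadius ℝ (G.adjMatrix ℝ)).toReal

/-- The graph `K_r^+[t]`: the complete `r`-partite graph whose parts `{i} × Fin t` all have `t`
vertices, with one edge added between the first two vertices of the first part
(meaningful for `1 ≤ r` and `2 ≤ t`). -/
def blowupPlus (r t : ℕ) : SimpleGraph (Fin r × Fin t) :=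
  SimpleGraph.completeEquipartiteGraph r t ⊔
    SimpleGraph.fromRel fun x y =>
      x.1.val = 0 ∧ y.1.val = 0 ∧ x.2.val = 0 ∧ y.2.val = 1

/-- The complete `r`-partite graph on the (pairwise disjoint) parts `U 0, …, U (r - 1)`, regarded
as a graph on `V` in which all vertices outside the parts are isolated. -/
def completePartite {V : Type*} {r : ℕ} (U : Fin r → Finset V) : SimpleGraph V where
  Adj u v := u ≠ v ∧ ∃ i j, i ≠ j ∧ u ∈ U i ∧ v ∈ U j
  symm := ⟨fun _ _ ⟨h, i, j, hij, hu, hv⟩ => ⟨h.symm, j, i, hij.symm, hv, hu⟩⟩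
  loopless := ⟨fun _ h => h.1 rfl⟩

/-- The graph `H`, viewed as a graph with vertex set `S`, is regular: all vertices in `S` have
the same degree in `H`. -/
def RegularOn {V : Type*} (H : SimpleGraph V) (S : Set V) : Prop :=
  ∃ d : ℕ, ∀ v ∈ S, (H.neighborSet v).ncard = d

/-- The edit distance of two graphs on the same vertex set: the number of edges that have to be
added or deleted to turn one into the other. -/
noncomputable def editDist {V : Type*} (G H : SimpleGraph V) : ℕ :=
  (symmDiff G.edgeSet H.edgeSet).ncard

/-- Up to isolated vertices, `G` is a complete `r`-partite graph (with nonempty parts). -/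
def IsCompletePartite {V : Type*} (r : ℕ) (G : SimpleGraph V) : Prop :=
  ∃ W : Fin r → Finset V, (∀ i, (W i).Nonempty) ∧ Pairwise (Function.onFun Disjoint W) ∧
    G = completePartite W

/-- Up to isolated vertices, `G` is a regular complete `r`-partite graph (with nonempty parts). -/
def IsRegularCompletePartite {V : Type*} (r : ℕ) (G : SimpleGraph V) : Prop :=
  ∃ W : Fin r → Finset V, (∀ i, (W i).Nonempty) ∧ Pairwise (Function.onFun Disjoint W) ∧
    G = completePartite W ∧ RegularOn G (⋃ i, (W i : Set V))

end EdgeSpectral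

/-! ### Greedy embedding and copies of K_r^+[t]. -/

namespace EdgeSpectral
open Finset

/-! Suppose λ(G)² ≥ (1 - 1/r)·2m, and let x ≥ 0 be a unit vector whose quadratic form q = Σ x_u x_v
over ordered adjacent pairs is at least λ(G). Cauchy–Schwarz over the 2m ordered edges gives q² ≤
2m·S with S = Σ x_u² x_v². Hence it suffices to prove a Motzkin–Straus type bound S ≤ 1 - 1/r for
the probability weight y = x².

For arbitrary weights this bound fails (a clique K_{r+1} is K_r^+[t]-free), but here y cannot be
concentrated. Since G is close to H, the vector x is nearly optimal for H and hence close to the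
Perron vector of H. As any two parts of H have the same product of sizes, the square of that vector
has weight 1/r on each part. So y has small atoms, is almost equidistributed over the parts, and
sees few missing pairs (`nearPartite_of_le_sq`).

For such y the bound is `NearPartite.sum_adj_le`. Colour each vertex by a part in which its
neighbourhood is light; one exists, since a vertex with heavy neighbourhoods in all parts would lie
in a K_r^+[t]. An edge inside a colour class must meet the set B of vertices missing substantial
weight in other classes, for otherwise it extends to a K_r^+[t]. A vertex of B loses more through
its missing pairs than inner edges can return, so S ≤ 1 - Σ Y_i² ≤ 1 - 1/r, where Y_i are the class
weights.

Equality forces y(B) = 0, a complete r-partite graph on the support of x, and x_u x_v constant on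
edges. For r ≥ 3 this makes x constant and the parts equal (`NearPartite.eq_and_isCompletePartite`).
Conversely, the extremal graphs attain the bound through an explicit eigenvector (`le_lam_sq`). -/

open Classical in
/-- Greedy embedding in a weighted graph: a vertex `a` of the pattern is embedded into its candidate
set `S a`, where each vertex rules out only weight `2 * β` for every later one. -/
lemma exists_greedy_embedding {V ι : Type*} [Fintype ι] (F : SimpleGraph ι)
    (G : SimpleGraph V) (y : V → ℝ) (hy : ∀ v, 0 ≤ y v) (S : ι → Finset V) (β : ℝ) (hβ : 0 ≤ β)
    (hatom : ∀ v, y v ≤ β)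
    (hmiss : ∀ a b, F.Adj a b → ∀ v ∈ S a, ∑ w ∈ S b with ¬ G.Adj v w, y w ≤ β)
    (hS : ∀ a, 2 * β * Fintype.card ι < ∑ w ∈ S a, y w) :
    ∃ φ : ι → V, Function.Injective φ ∧ (∀ a, φ a ∈ S a) ∧
      ∀ a b, F.Adj a b → G.Adj (φ a) (φ b) := by
  have hne : ∀ a, ∃ v, v ∈ S a := by
    intro a
    by_contra! h
    have h0 : S a = ∅ := Finset.eq_empty_of_forall_notMem h
    have := hS a
    rw [h0, Finset.sum_empty] at this
    have : 0 ≤ 2 * β * Fintype.card ι := by positivity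
    linarith
  choose φ₀ hφ₀ using hne
  suffices H : ∀ s : Finset ι, ∃ φ : ι → V, Set.InjOn φ s ∧ (∀ a ∈ s, φ a ∈ S a) ∧
      ∀ a ∈ s, ∀ b ∈ s, F.Adj a b → G.Adj (φ a) (φ b) by
    obtain ⟨φ, h1, h2, h3⟩ := H Finset.univ
    exact ⟨φ, fun a b h => h1 (by simp) (by simp) h, fun a => h2 a (by simp),
      fun a b => h3 a (by simp) b (by simp)⟩
  intro s
  induction s using Finset.induction_on with
  | empty => exact ⟨φ₀, by simp, by simp, by simp⟩
  | insert a s ha ih =>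
    obtain ⟨φ, h1, h2, h3⟩ := ih
    have key : ∃ w ∈ S a, ∀ b ∈ s, w ≠ φ b ∧ (F.Adj b a → G.Adj (φ b) w) := by
      by_contra! h
      -- If no `w` works, each `w` in `S a` is charged to some embedded `b`, either as its image or
      -- as a non-neighbour of it. Each `b` absorbs weight at most 2β, too little to exhaust `S a`.
      have hle : ∑ w ∈ S a, y w ≤ ∑ w ∈ S a, ∑ b ∈ s,
          ((if w = φ b then y w else 0) + (if F.Adj b a ∧ ¬ G.Adj (φ b) w then y w else 0)) := by
        refine Finset.sum_le_sum fun w hw => ?_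
        obtain ⟨b, hb, hbw⟩ := h w hw
        refine le_trans ?_ (Finset.single_le_sum (f := fun b =>
          ((if w = φ b then y w else 0) + (if F.Adj b a ∧ ¬ G.Adj (φ b) w then y w else 0)))
          (fun c _ => ?_) hb)
        · by_cases hwb : w = φ b
          · simp only [hwb, if_true]
            have : 0 ≤ (if F.Adj b a ∧ ¬ G.Adj (φ b) (φ b) then y (φ b) else 0) := by
              split_ifs <;> simp [hy]
            linarith
          · have := hbw hwb
            simp [hwb, this]
        · have := hy w
          split_ifs <;> linarith
      rw [Finset.sum_comm] at hle
      have h2b : ∀ b ∈ s, ∑ w ∈ S a, ((if w = φ b then y w else 0) +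
          (if F.Adj b a ∧ ¬ G.Adj (φ b) w then y w else 0)) ≤ 2 * β := by
        intro b hb
        rw [Finset.sum_add_distrib]
        have e1 : ∑ w ∈ S a, (if w = φ b then y w else 0) ≤ β := by
          rw [Finset.sum_ite_eq']
          split_ifs
          · exact hatom _
          · exact hβ
        have e2 : ∑ w ∈ S a, (if F.Adj b a ∧ ¬ G.Adj (φ b) w then y w else 0) ≤ β := by
          by_cases hF : F.Adj b a
          · simp only [hF, true_and]
            rw [← Finset.sum_filter]
            exact hmiss b a hF _ (h2 b hb)
          · simpa [hF] using hβ
        linarith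
      have h3b := Finset.sum_le_card_nsmul s _ _ h2b
      have h4 : (s.card : ℝ) ≤ Fintype.card ι := by exact_mod_cast Finset.card_le_univ s
      have h5 := hS a
      rw [nsmul_eq_mul] at h3b
      nlinarith
    obtain ⟨w, hw, hws⟩ := key
    have hne : ∀ b ∈ s, b ≠ a := fun b hb h => ha (h ▸ hb)
    refine ⟨Function.update φ a w, ?_, ?_, ?_⟩
    · intro b hb c hc hbc
      simp only [Finset.coe_insert, Set.mem_insert_iff, Finset.mem_coe] at hb hc
      rcases hb with rfl | hb <;> rcases hc with rfl | hc
      · rfl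
      · simp only [Function.update_self, Function.update_of_ne (hne c hc)] at hbc
        exact absurd hbc (hws c hc).1
      · simp only [Function.update_self, Function.update_of_ne (hne b hb)] at hbc
        exact absurd hbc.symm (hws b hb).1
      · simp only [Function.update_of_ne (hne c hc), Function.update_of_ne (hne b hb)] at hbc
        exact h1 hb hc hbc
    · intro b hb
      rcases Finset.mem_insert.1 hb with rfl | hb
      · simpa using hw
      · simpa [Function.update_of_ne (hne b hb)] using h2 b hb
    · intro b hb c hc hF
      rcases Finset.mem_insert.1 hb with rfl | hb' <;> rcases Finset.mem_insert.1 hc with rfl | hc'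
      · exact absurd hF (F.loopless.irrefl _)
      · simp only [Function.update_self, Function.update_of_ne (hne c hc')]
        exact ((hws c hc').2 hF.symm).symm
      · simp only [Function.update_self, Function.update_of_ne (hne b hb')]
        exact (hws b hb').2 hF
      · simp only [Function.update_of_ne (hne c hc'), Function.update_of_ne (hne b hb')]
        exact h3 b hb' c hc' hF

lemma blowupPlus_adj {r t : ℕ} {a b : Fin r × Fin t} (h : (blowupPlus r t).Adj a b) :
    a.1 ≠ b.1 ∨ (a.1.val = 0 ∧ b.1.val = 0 ∧ a.2.val = 0 ∧ b.2.val = 1) ∨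
      (b.1.val = 0 ∧ a.1.val = 0 ∧ b.2.val = 0 ∧ a.2.val = 1) := by
  simp only [blowupPlus, SimpleGraph.sup_adj, SimpleGraph.completeEquipartiteGraph_adj,
    SimpleGraph.fromRel_adj] at h
  tauto

/-- An injective map preserving the adjacencies of `K_r^+[t]` gives a copy of it. -/
lemma not_free_of_injective {V : Type*} {G : SimpleGraph V} {r t : ℕ} (φ : Fin r × Fin t → V)
    (hφ : Function.Injective φ)
    (h1 : ∀ a b, a.1 ≠ b.1 → G.Adj (φ a) (φ b))
    (h2 : ∀ a b : Fin r × Fin t, a.1.val = 0 → b.1.val = 0 → a.2.val = 0 → b.2.val = 1 →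
      G.Adj (φ a) (φ b)) : ¬ (blowupPlus r t).Free G := by
  intro hfree
  refine hfree ⟨⟨⟨φ, ?_⟩, hφ⟩⟩
  intro a b hab
  rcases blowupPlus_adj hab with h | h | h
  · exact h1 a b h
  · exact h2 a b h.1 h.2.1 h.2.2.1 h.2.2.2
  · exact (h2 b a h.1 h.2.1 h.2.2.1 h.2.2.2).symm

/-! ### Near-partite weights and forbidden configurations. -/

open Classical in
/-- The probability weight `y` has atoms at most `β`, is nearly equidistributed over the parts `U i`,
and almost all pairs in different parts (with respect to `y`) are adjacent in `G`. -/
structure NearPartite {V : Type*} [Fintype V] {r : ℕ} (G : SimpleGraph V) (y : V → ℝ)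
    (U : Fin r → Finset V) (β : ℝ) : Prop where
  nonneg : ∀ v, 0 ≤ y v
  sum_one : ∑ v, y v = 1
  pos : 0 < β
  atom : ∀ v, y v ≤ β
  disj : Pairwise (Function.onFun Disjoint U)
  part : ∀ i, 1 / (r : ℝ) - β ^ 2 ≤ ∑ v ∈ U i, y v
  miss : ∑ u, ∑ v, (if (completePartite U).Adj u v ∧ ¬ G.Adj u v then y u * y v else 0) ≤ β ^ 2

open Classical in
/-- The weight of the neighbours of `u` in `completePartite U` that are not neighbours in `G`. -/
noncomputable def missWeight {V : Type*} [Fintype V] {r : ℕ} (G : SimpleGraph V) (y : V → ℝ)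
    (U : Fin r → Finset V) (u : V) : ℝ :=
  ∑ v, if (completePartite U).Adj u v ∧ ¬ G.Adj u v then y v else 0

namespace NearPartite

variable {V : Type*} [Fintype V] {r t : ℕ} {G : SimpleGraph V} {y : V → ℝ}
  {U : Fin r → Finset V} {β : ℝ}

lemma eq_of_mem (h : NearPartite G y U β) {v : V} {i j : Fin r} (hi : v ∈ U i) (hj : v ∈ U j) :
    i = j := by
  by_contra hij
  exact Finset.disjoint_left.1 (h.disj hij) hi hj

-- Markov's inequality: the `y`-average of the missing weight is at most β².
open Classical in
lemma weight_bad_le (h : NearPartite G y U β) :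
    ∑ u with β < missWeight G y U u, y u ≤ β := by
  have h1 : β * ∑ u with β < missWeight G y U u, y u ≤ β ^ 2 := by
    refine le_trans ?_ h.miss
    rw [Finset.mul_sum]
    calc ∑ u with β < missWeight G y U u, β * y u
        ≤ ∑ u with β < missWeight G y U u, y u * missWeight G y U u := by
          refine Finset.sum_le_sum fun u hu => ?_
          rw [mul_comm]
          exact mul_le_mul_of_nonneg_left (Finset.mem_filter.1 hu).2.le (h.nonneg u)
      _ ≤ ∑ u, y u * missWeight G y U u := by
          refine Finset.sum_le_sum_of_subset_of_nonneg (Finset.filter_subset _ _) fun u _ _ => ?_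
          refine mul_nonneg (h.nonneg u) (Finset.sum_nonneg fun v _ => ?_)
          split_ifs
          · exact h.nonneg v
          · exact le_rfl
      _ = _ := by
          refine Finset.sum_congr rfl fun u _ => ?_
          rw [missWeight, Finset.mul_sum]
          refine Finset.sum_congr rfl fun v _ => ?_
          split_ifs <;> simp
  have := h.pos
  nlinarith

open Classical in
/-- Weight lost by intersecting with the vertices of small missing weight. -/
lemma sum_sub_le_sum_good (h : NearPartite G y U β) (S : Finset V) :
    ∑ v ∈ S, y v - β ≤ ∑ v ∈ S with missWeight G y U v ≤ β, y v := by
  have h1 := Finset.sum_filter_add_sum_filter_not S (fun v => missWeight G y U v ≤ β) y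
  have h2 : ∑ v ∈ S with ¬ missWeight G y U v ≤ β, y v ≤
      ∑ u with β < missWeight G y U u, y u := by
    refine Finset.sum_le_sum_of_subset_of_nonneg ?_ fun u _ _ => h.nonneg u
    intro v hv
    simpa using (Finset.mem_filter.1 hv).2
  have := h.weight_bad_le
  linarith

-- Restricting to prescribed sets `S i` of good vertices allows adjacency to further vertices to be
-- imposed on the copy of K_r[t]. The permutation allows any part to play the role of the first,
-- which carries the added edge.
open Classical in
lemma exists_blowup (h : NearPartite G y U β) (σ : Equiv.Perm (Fin r)) (S : Fin r → Finset V)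
    (hSU : ∀ i, ∀ v ∈ S i, v ∈ U (σ i) ∧ missWeight G y U v ≤ β)
    (hS : ∀ i, 2 * β * (r * t) < ∑ v ∈ S i, y v) :
    ∃ φ : Fin r × Fin t → V, Function.Injective φ ∧ (∀ a, φ a ∈ S a.1) ∧
      ∀ a b, a.1 ≠ b.1 → G.Adj (φ a) (φ b) := by
  have hm : ∀ a b, (SimpleGraph.completeEquipartiteGraph r t).Adj a b → ∀ v ∈ S a.1,
      ∑ w ∈ S b.1 with ¬ G.Adj v w, y w ≤ β := by
    intro a b hab v hv
    rw [SimpleGraph.completeEquipartiteGraph_adj] at hab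
    refine le_trans ?_ (hSU _ v hv).2
    rw [missWeight, ← Finset.sum_filter]
    refine Finset.sum_le_sum_of_subset_of_nonneg ?_ fun u _ _ => h.nonneg u
    intro w hw
    obtain ⟨hw, hvw⟩ := Finset.mem_filter.1 hw
    have hne : σ a.1 ≠ σ b.1 := σ.injective.ne hab
    have hU1 := (hSU _ v hv).1
    have hU2 := (hSU _ w hw).1
    simp only [Finset.mem_filter, Finset.mem_univ, true_and]
    refine ⟨⟨?_, _, _, hne, hU1, hU2⟩, hvw⟩
    rintro rfl
    exact hne (h.eq_of_mem hU1 hU2)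
  obtain ⟨φ, h1, h2, h3⟩ := exists_greedy_embedding (SimpleGraph.completeEquipartiteGraph r t) G y
    h.nonneg (fun a => S a.1) β h.pos.le h.atom hm (fun a => by simpa using hS a.1)
  refine ⟨φ, h1, h2, fun a b hab => h3 a b ?_⟩
  rwa [SimpleGraph.completeEquipartiteGraph_adj]

open Classical in
/-- In a `K_r^+[t]`-free graph, each neighbourhood has small weight in some part. -/
lemma exists_small_nbhd (h : NearPartite G y U β) (hr : 2 ≤ r) (ht : 2 ≤ t)
    (hfree : (blowupPlus r t).Free G) (u : V) :
    ∃ i, ∑ v ∈ U i with G.Adj u v, y v < 4 * (r * t) * β := by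
  by_contra! hu
  have hβ := h.pos
  have hrt : (4 : ℝ) ≤ r * t := by exact_mod_cast Nat.mul_le_mul hr ht
  obtain ⟨φ, h1, h2, h3⟩ := h.exists_blowup (t := t) 1
    (fun i => {v ∈ {v ∈ U i | G.Adj u v} | missWeight G y U v ≤ β})
    (fun i v hv => by
      simp only [Finset.mem_filter] at hv
      exact ⟨hv.1.1, hv.2⟩)
    -- Discarding bad vertices costs at most β, so more than the required 2rtβ survives of 4rtβ.
    (fun i => by
      have := h.sum_sub_le_sum_good {v ∈ U i | G.Adj u v}
      have := hu i
      nlinarith)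
  have hadj : ∀ a, G.Adj u (φ a) := fun a => by
    have := h2 a
    simp only [Finset.mem_filter] at this
    exact this.1.2
  set o : Fin r × Fin t := (⟨0, by omega⟩, ⟨0, by omega⟩) with ho
  -- A whole K_r[t] lies in the neighbourhood of `u`, so `u` can replace one end of the added edge:
  -- it is adjacent even to the rest of its own part.
  refine not_free_of_injective (Function.update φ o u) ?_ ?_ ?_ hfree
  · intro a b hab
    by_cases ha : a = o <;> by_cases hb : b = o
    · rw [ha, hb]
    · subst ha
      rw [Function.update_self, Function.update_of_ne hb] at hab
      exact absurd (hab ▸ hadj b) (G.loopless.irrefl _)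
    · subst hb
      rw [Function.update_self, Function.update_of_ne ha] at hab
      exact absurd (hab ▸ hadj a) (G.loopless.irrefl _)
    · rw [Function.update_of_ne ha, Function.update_of_ne hb] at hab
      exact h1 hab
  · intro a b hab
    by_cases ha : a = o <;> by_cases hb : b = o
    · exact absurd (by rw [ha, hb]) hab
    · subst ha
      rw [Function.update_self, Function.update_of_ne hb]
      exact hadj b
    · subst hb
      rw [Function.update_self, Function.update_of_ne ha]
      exact (hadj a).symm
    · rw [Function.update_of_ne ha, Function.update_of_ne hb]
      exact h3 a b hab
  · intro a b h1 h2 h3 h4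
    have ha : a = o := by
      rw [ho]; ext <;> simp [h1, h3]
    have hb : b ≠ o := by
      rintro rfl
      simp [ho] at h4
    subst ha
    rw [Function.update_self, Function.update_of_ne hb]
    exact hadj b

open Classical in
/-- In a `K_r^+[t]`-free graph, the ends of an edge cannot both be adjacent to almost all vertices
in the same `r - 1` parts. -/
lemma not_adj_of_nbhd_large (h : NearPartite G y U β) (hr : 2 ≤ r) (ht : 2 ≤ t)
    (hfree : (blowupPlus r t).Free G) {γ : ℝ} (hγ0 : 0 ≤ γ)
    (hγ : 2 * β * (r * t) + 2 * γ + 4 * β < 1 / r) {u v : V} {i : Fin r}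
    (hu : ∀ j, j ≠ i → ∑ w ∈ U j with ¬ G.Adj u w, y w ≤ γ)
    (hv : ∀ j, j ≠ i → ∑ w ∈ U j with ¬ G.Adj v w, y w ≤ γ) : ¬ G.Adj u v := by
  intro huv
  have hβ := h.pos
  have hrt : (4 : ℝ) ≤ r * t := by exact_mod_cast Nat.mul_le_mul hr ht
  set z : Fin r := ⟨0, by omega⟩ with hz
  -- Part `i`, where nothing is known about the neighbourhoods of `u` and `v`, takes the role of
  -- part 0. There `u` and `v` become the ends of the added edge, and only the other parts have to
  -- be adjacent to them.
  set σ : Equiv.Perm (Fin r) := Equiv.swap z i with hσ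
  have hβ1 : β ≤ 1 := by
    have : (1 : ℝ) / r ≤ 1 := by
      rw [div_le_one (by positivity)]; exact_mod_cast (by omega)
    nlinarith
  have hσi : ∀ j, j ≠ z → σ j ≠ i := by
    intro j hj hji
    apply hj
    apply σ.injective
    rw [hji, hσ, Equiv.swap_apply_left]
  obtain ⟨φ, h1, h2, h3⟩ := h.exists_blowup (t := t) σ
    (fun j => {w ∈ {w ∈ U (σ j) | w ≠ u ∧ w ≠ v ∧ (j ≠ z → G.Adj u w ∧ G.Adj v w)} |
      missWeight G y U w ≤ β})
    (fun i v hv => by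
      simp only [Finset.mem_filter] at hv
      exact ⟨hv.1.1, hv.2⟩)
    (fun j => by
      have e1 := h.sum_sub_le_sum_good
        {w ∈ U (σ j) | w ≠ u ∧ w ≠ v ∧ (j ≠ z → G.Adj u w ∧ G.Adj v w)}
      have e2 := h.part (σ j)
      have e3 : ∑ w ∈ U (σ j), y w ≤
          ∑ w ∈ U (σ j) with w ≠ u ∧ w ≠ v ∧ (j ≠ z → G.Adj u w ∧ G.Adj v w), y w
          + (2 * γ + 2 * β) := by
        have hp : ∀ w ∈ U (σ j), y w ≤
            (if w ≠ u ∧ w ≠ v ∧ (j ≠ z → G.Adj u w ∧ G.Adj v w) then y w else 0) +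
            ((if w = u then y w else 0) + (if w = v then y w else 0) +
            ((if j ≠ z ∧ ¬ G.Adj u w then y w else 0) +
              (if j ≠ z ∧ ¬ G.Adj v w then y w else 0))) := by
          intro w _
          have := h.nonneg w
          have n1 : (0 : ℝ) ≤ (if w = u then y w else 0) := by split_ifs <;> simp [this]
          have n2 : (0 : ℝ) ≤ (if w = v then y w else 0) := by split_ifs <;> simp [this]
          have n3 : (0 : ℝ) ≤ (if j ≠ z ∧ ¬ G.Adj u w then y w else 0) := by
            split_ifs <;> simp [this]
          have n4 : (0 : ℝ) ≤ (if j ≠ z ∧ ¬ G.Adj v w then y w else 0) := by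
            split_ifs <;> simp [this]
          by_cases c1 : w = u
          · rw [if_pos c1] at *
            split_ifs <;> linarith
          by_cases c2 : w = v
          · rw [if_pos c2] at *
            split_ifs <;> linarith
          by_cases c3 : j ≠ z ∧ ¬ G.Adj u w
          · rw [if_pos c3] at *
            split_ifs <;> linarith
          by_cases c4 : j ≠ z ∧ ¬ G.Adj v w
          · rw [if_pos c4] at *
            split_ifs <;> linarith
          rw [if_pos (by tauto)]
          linarith
        refine (Finset.sum_le_sum hp).trans ?_
        simp only [Finset.sum_add_distrib]
        rw [← Finset.sum_filter]
        have a1 : ∀ x, ∑ w ∈ U (σ j), (if w = x then y w else 0) ≤ β := by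
          intro x
          rw [Finset.sum_ite_eq']
          split_ifs
          · exact h.atom _
          · exact hβ.le
        have a2 : ∀ x, (∀ j, j ≠ i → ∑ w ∈ U j with ¬ G.Adj x w, y w ≤ γ) →
            ∑ w ∈ U (σ j), (if j ≠ z ∧ ¬ G.Adj x w then y w else 0) ≤ γ := by
          intro x hx
          by_cases hj : j = z
          · simpa [hj] using hγ0
          · simp only [ne_eq, hj, not_false_eq_true, true_and]
            rw [← Finset.sum_filter]
            exact hx _ (hσi j hj)
        have := a1 u
        have := a1 v
        have := a2 u hu
        have := a2 v hv
        linarith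
      nlinarith)
  have hmem : ∀ a, φ a ≠ u ∧ φ a ≠ v ∧ (a.1 ≠ z → G.Adj u (φ a) ∧ G.Adj v (φ a)) := fun a => by
    have := h2 a
    simp only [Finset.mem_filter] at this
    exact this.1.2
  set o : Fin r × Fin t := (z, ⟨0, by omega⟩) with ho
  set o' : Fin r × Fin t := (z, ⟨1, by omega⟩) with ho'
  have hoo : o ≠ o' := by simp [ho, ho']
  set ψ : Fin r × Fin t → V := fun a => if a = o then u else if a = o' then v else φ a with hψ
  have ψo : ψ o = u := by simp [hψ]
  have ψo' : ψ o' = v := by simp [hψ, hoo.symm]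
  have ψa : ∀ a, a ≠ o → a ≠ o' → ψ a = φ a := fun a h1 h2 => by simp [hψ, h1, h2]
  have hψcases : ∀ a, a = o ∨ a = o' ∨ (a ≠ o ∧ a ≠ o' ∧ ψ a = φ a) := fun a => by
    by_cases h1 : a = o
    · exact Or.inl h1
    by_cases h2 : a = o'
    · exact Or.inr (Or.inl h2)
    exact Or.inr (Or.inr ⟨h1, h2, ψa a h1 h2⟩)
  refine not_free_of_injective ψ ?_ ?_ ?_ hfree
  · intro a b hab
    rcases hψcases a with rfl | rfl | ⟨-, -, ha⟩ <;> rcases hψcases b with rfl | rfl | ⟨-, -, hb⟩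
    · rfl
    · rw [ψo, ψo'] at hab; exact absurd hab huv.ne
    · rw [ψo, hb] at hab; exact absurd hab.symm (hmem b).1
    · rw [ψo, ψo'] at hab; exact absurd hab.symm huv.ne
    · rfl
    · rw [ψo', hb] at hab; exact absurd hab.symm (hmem b).2.1
    · rw [ψo, ha] at hab; exact absurd hab (hmem a).1
    · rw [ψo', ha] at hab; exact absurd hab (hmem a).2.1
    · rw [ha, hb] at hab; exact h1 hab
  · intro a b hab
    rcases hψcases a with rfl | rfl | ⟨-, -, ha⟩ <;> rcases hψcases b with rfl | rfl | ⟨-, -, hb⟩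
    · exact absurd rfl hab
    · exact absurd rfl hab
    · rw [ψo, hb]; exact ((hmem b).2.2 (Ne.symm hab)).1
    · exact absurd rfl hab
    · exact absurd rfl hab
    · rw [ψo', hb]; exact ((hmem b).2.2 (Ne.symm hab)).2
    · rw [ψo, ha]; exact ((hmem a).2.2 hab).1.symm
    · rw [ψo', ha]; exact ((hmem a).2.2 hab).2.symm
    · rw [ha, hb]; exact h3 a b hab
  · intro a b h1 h2 h3 h4
    have ha : a = o := by
      rw [ho]; ext <;> simp [h1, h3, hz]
    have hb : b = o' := by
      rw [ho']; ext <;> simp [h2, h4, hz]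
    rw [ha, hb, ψo, ψo']
    exact huv

end NearPartite

/-! ### The weighted Turán bound. -/

namespace NearPartite

variable {V : Type*} [Fintype V] {r t : ℕ} {G : SimpleGraph V} {y : V → ℝ}
  {U : Fin r → Finset V} {β : ℝ}

open Classical in
/-- The classes of a suitable colouring of a `K_r^+[t]`-free graph agree with the given parts up to
small weight, and inner degrees are small. -/
lemma exists_coloring (h : NearPartite G y U β) (hr : 2 ≤ r) (ht : 2 ≤ t)
    (hβ : 100 * r * (r * t) * β = 1) (hfree : (blowupPlus r t).Free G) :
    ∃ f : V → Fin r, ∑ v with v ∉ U (f v), y v ≤ 2 * β ∧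
      ∀ u, ∑ v with f v = f u ∧ G.Adj u v, y v ≤ 4 * (r * t) * β + 2 * β := by
  choose f hf using h.exists_small_nbhd hr ht hfree
  have hβ0 := h.pos
  have hr0 : (2 : ℝ) ≤ r := by exact_mod_cast hr
  have hrt : (4 : ℝ) ≤ r * t := by exact_mod_cast Nat.mul_le_mul hr ht
  have hR : (1 : ℝ) / r = 100 * (r * t) * β := by
    rw [div_eq_iff (by positivity)]; linarith
  have hrβ : r * β ≤ 1 := by nlinarith
  have hβ1 : β ≤ 1 := by nlinarith
  -- A good vertex of `U j` sees almost all of every other part, so its neighbourhood can be light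
  -- only in its own.
  have hgood : ∀ j, ∀ u ∈ U j, missWeight G y U u ≤ β → f u = j := by
    intro j u huj hu
    by_contra hne
    have e1 := hf u
    have e2 := h.part (f u)
    have e3 := Finset.sum_filter_add_sum_filter_not (U (f u)) (fun v => G.Adj u v) y
    have e4 : ∑ v ∈ U (f u) with ¬ G.Adj u v, y v ≤ missWeight G y U u := by
      rw [missWeight, ← Finset.sum_filter]
      refine Finset.sum_le_sum_of_subset_of_nonneg ?_ fun u _ _ => h.nonneg u
      intro w hw
      obtain ⟨hw, hvw⟩ := Finset.mem_filter.1 hw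
      simp only [Finset.mem_filter, Finset.mem_univ, true_and]
      refine ⟨⟨?_, j, f u, Ne.symm hne, huj, hw⟩, hvw⟩
      rintro rfl
      exact hne (h.eq_of_mem hw huj)
    nlinarith
  have hZ : ∑ v with v ∉ U (f v), y v ≤ 2 * β := by
    have e1 : ∑ v with v ∉ U (f v), y v ≤ ∑ v with v ∉ Finset.univ.biUnion U, y v +
        ∑ u with β < missWeight G y U u, y u := by
      refine le_trans (Finset.sum_le_sum_of_subset_of_nonneg (t :=
        ({v | v ∉ Finset.univ.biUnion U} : Finset V) ∪ ({u | β < missWeight G y U u} : Finset V)) ?_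
        fun u _ _ => h.nonneg u) ?_
      · intro v hv
        simp only [Finset.mem_filter, Finset.mem_univ, true_and, Finset.mem_union,
          Finset.mem_biUnion, not_exists] at hv ⊢
        by_contra! hcon
        obtain ⟨⟨j, hj⟩, hm⟩ := hcon
        exact hv (hgood j v hj hm ▸ hj)
      · rw [← Finset.sum_union_inter]
        have := Finset.sum_nonneg (s := ({v | v ∉ Finset.univ.biUnion U} : Finset V) ∩
          ({u | β < missWeight G y U u} : Finset V)) fun u _ => h.nonneg u
        linarith
    have e2 : ∑ v with v ∉ Finset.univ.biUnion U, y v ≤ r * β ^ 2 := by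
      have e3 := Finset.sum_filter_add_sum_filter_not Finset.univ
        (fun v => v ∈ Finset.univ.biUnion U) y
      rw [h.sum_one, Finset.filter_mem_eq_inter, Finset.univ_inter, Finset.sum_biUnion
        (fun i _ j _ hij => h.disj hij)] at e3
      have e4 : ∑ i : Fin r, (1 / (r : ℝ) - β ^ 2) ≤ ∑ i, ∑ v ∈ U i, y v :=
        Finset.sum_le_sum fun i _ => h.part i
      rw [Finset.sum_const, Finset.card_univ, Fintype.card_fin, nsmul_eq_mul, mul_sub,
        mul_one_div_cancel (by positivity)] at e4
      linarith
    have := h.weight_bad_le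
    nlinarith
  refine ⟨f, hZ, fun u => ?_⟩
  have : ∑ v with f v = f u ∧ G.Adj u v, y v ≤
      ∑ v ∈ U (f u) with G.Adj u v, y v + ∑ v with v ∉ U (f v), y v := by
    refine le_trans (Finset.sum_le_sum_of_subset_of_nonneg (t :=
        {v ∈ U (f u) | G.Adj u v} ∪ ({v | v ∉ U (f v)} : Finset V)) ?_ fun u _ _ => h.nonneg u) ?_
    · intro v hv
      simp only [Finset.mem_filter, Finset.mem_univ, true_and, Finset.mem_union] at hv ⊢
      rw [hv.1]
      tauto
    · rw [← Finset.sum_union_inter]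
      have := Finset.sum_nonneg (s := {v ∈ U (f u) | G.Adj u v} ∩ ({v | v ∉ U (f v)} : Finset V))
        fun u _ => h.nonneg u
      linarith
  have := hf u
  linarith

open Classical in
/-- Weighted Turán bound for `K_r^+[t]`-free graphs close to complete `r`-partite ones. -/
lemma sum_adj_le (h : NearPartite G y U β) (hr : 2 ≤ r) (ht : 2 ≤ t)
    (hβ : 100 * r * (r * t) * β = 1) (hfree : (blowupPlus r t).Free G) :
    ∑ u, ∑ v, (if G.Adj u v then y u * y v else 0) ≤ 1 - 1 / (r : ℝ) ∧
    (∑ u, ∑ v, (if G.Adj u v then y u * y v else 0) = 1 - 1 / (r : ℝ) →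
      ∃ f : V → Fin r, (∀ u v, 0 < y u → 0 < y v → (G.Adj u v ↔ f u ≠ f v)) ∧
        ∀ i, ∑ v with f v = i, y v = 1 / (r : ℝ)) := by
  obtain ⟨f, hZ, hin⟩ := h.exists_coloring hr ht hβ hfree
  have hβ0 := h.pos
  have hr0 : (2 : ℝ) ≤ r := by exact_mod_cast hr
  have hrt : (4 : ℝ) ≤ r * t := by exact_mod_cast Nat.mul_le_mul hr ht
  have hR : (1 : ℝ) / r = 100 * (r * t) * β := by
    rw [div_eq_iff (by positivity)]; linarith
  have hβN : 4 * β ≤ (r * t) * β := by nlinarith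
  -- The threshold for `B` must be well below 1/r, so that edges avoiding `B` are covered by
  -- `not_adj_of_nbhd_large`, yet above twice the inner degree bound. In units of rtβ, 1/r is 100,
  -- `c` is 12.5 and twice the inner degree bound is at most 9.
  set c : ℝ := 1 / (8 * r) with hc
  have hcR : 8 * c = 1 / (r : ℝ) := by rw [hc]; field_simp
  have hc0 : 0 < c := by positivity
  set ms : V → ℝ := fun u => ∑ v with f v ≠ f u ∧ ¬ G.Adj u v, y v with hms
  set B : Finset V := {u | c ≤ ms u} with hB
  have hB' : ∀ u, u ∉ B → ∀ j, j ≠ f u → ∑ w ∈ U j with ¬ G.Adj u w, y w ≤ c + 2 * β := by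
    intro u hu j hj
    have hu' : ms u < c := by simpa [hB] using hu
    have : ∑ w ∈ U j with ¬ G.Adj u w, y w ≤ ms u + ∑ v with v ∉ U (f v), y v := by
      refine le_trans (Finset.sum_le_sum_of_subset_of_nonneg (t :=
        ({v | f v ≠ f u ∧ ¬ G.Adj u v} : Finset V) ∪ ({v | v ∉ U (f v)} : Finset V)) ?_
        fun u _ _ => h.nonneg u) ?_
      · intro v hv
        simp only [Finset.mem_filter, Finset.mem_univ, true_and, Finset.mem_union] at hv ⊢
        by_cases hvf : v ∈ U (f v)
        · left
          rw [h.eq_of_mem hvf hv.1]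
          exact ⟨hj, hv.2⟩
        · exact Or.inr hvf
      · rw [hms]
        dsimp only
        rw [← Finset.sum_union_inter]
        have := Finset.sum_nonneg (s := ({v | f v ≠ f u ∧ ¬ G.Adj u v} : Finset V) ∩
          ({v | v ∉ U (f v)} : Finset V)) fun u _ => h.nonneg u
        linarith
    linarith
  have hedge : ∀ u v, G.Adj u v → f u = f v → u ∈ B ∨ v ∈ B := by
    intro u v huv hf
    by_contra! hcon
    refine h.not_adj_of_nbhd_large hr ht hfree (γ := c + 2 * β) (i := f u) (by positivity) ?_
      (hB' u hcon.1) (hf ▸ hB' v hcon.2) huv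
    nlinarith
  set Y : Fin r → ℝ := fun i => ∑ v with f v = i, y v with hY
  set inner : ℝ := ∑ u, ∑ v, (if f v = f u ∧ G.Adj u v then y u * y v else 0) with hinner
  set miss : ℝ := ∑ u, ∑ v, (if f v ≠ f u ∧ ¬ G.Adj u v then y u * y v else 0) with hmiss
  have hsame : ∑ u, ∑ v, (if f v = f u then y u * y v else 0) = ∑ i, Y i ^ 2 := by
    have e1 : ∀ u, ∑ v, (if f v = f u then y u * y v else 0) = y u * Y (f u) := by
      intro u
      rw [← Finset.sum_filter, ← Finset.mul_sum]
    simp only [e1]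
    rw [← Finset.sum_fiberwise Finset.univ f]
    refine Finset.sum_congr rfl fun i _ => ?_
    rw [sq, hY, Finset.sum_mul]
    refine Finset.sum_congr rfl fun v hv => ?_
    rw [(Finset.mem_filter.1 hv).2]
  have hall : ∑ u, ∑ v, y u * y v = 1 := by
    rw [← Finset.sum_mul_sum, h.sum_one, one_mul]
  have hid : ∑ u, ∑ v, (if G.Adj u v then y u * y v else 0) = 1 - ∑ i, Y i ^ 2 - miss + inner := by
    rw [← hsame, ← hall, hmiss, hinner, ← Finset.sum_sub_distrib, ← Finset.sum_sub_distrib,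
      ← Finset.sum_add_distrib]
    refine Finset.sum_congr rfl fun u _ => ?_
    rw [← Finset.sum_sub_distrib, ← Finset.sum_sub_distrib, ← Finset.sum_add_distrib]
    refine Finset.sum_congr rfl fun v _ => ?_
    by_cases h1 : f v = f u <;> by_cases h2 : G.Adj u v <;> simp [h1, h2]
  have hYsum : ∑ i, Y i = 1 := by
    rw [hY, Finset.sum_fiberwise, h.sum_one]
  have hvar : ∑ i, (Y i - 1 / r) ^ 2 = ∑ i, Y i ^ 2 - 1 / r := by
    have : ∀ i, (Y i - 1 / r) ^ 2 = Y i ^ 2 - 2 / r * Y i + (1 / r) ^ 2 := fun i => by ring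
    simp only [this, Finset.sum_add_distrib, Finset.sum_sub_distrib, ← Finset.mul_sum, hYsum,
      Finset.sum_const, Finset.card_univ, Fintype.card_fin, nsmul_eq_mul]
    field_simp
    ring
  have hvar0 : 0 ≤ ∑ i, (Y i - 1 / r) ^ 2 := Finset.sum_nonneg fun i _ => sq_nonneg _
  -- Every inner edge has an end in `B`; the factor 2 allows it to be either entry of the ordered
  -- pair.
  have hinner_le : inner ≤ 2 * ((4 * (r * t) * β + 2 * β) * ∑ u ∈ B, y u) := by
    have e1 : inner ≤ ∑ u, ∑ v, ((if u ∈ B ∧ f v = f u ∧ G.Adj u v then y u * y v else 0) +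
        (if v ∈ B ∧ f v = f u ∧ G.Adj u v then y u * y v else 0)) := by
      refine Finset.sum_le_sum fun u _ => Finset.sum_le_sum fun v _ => ?_
      have := mul_nonneg (h.nonneg u) (h.nonneg v)
      by_cases huv : f v = f u ∧ G.Adj u v
      · rcases hedge u v huv.2 huv.1.symm with hb | hb
        · simp only [huv, hb, and_self, and_true, if_true]
          split_ifs <;> linarith
        · simp only [huv, hb, and_self, and_true, if_true]
          split_ifs <;> linarith
      · simp [huv]
    have e2 : ∑ u, ∑ v, (if u ∈ B ∧ f v = f u ∧ G.Adj u v then y u * y v else 0) ≤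
        (4 * (r * t) * β + 2 * β) * ∑ u ∈ B, y u := by
      have e3 : ∀ u, ∑ v, (if u ∈ B ∧ f v = f u ∧ G.Adj u v then y u * y v else 0) ≤
          if u ∈ B then (4 * (r * t) * β + 2 * β) * y u else 0 := by
        intro u
        by_cases hu : u ∈ B
        · simp only [hu, true_and, if_true]
          rw [← Finset.sum_filter, ← Finset.mul_sum, mul_comm]
          exact mul_le_mul_of_nonneg_right (hin u) (h.nonneg u)
        · simp [hu]
      refine (Finset.sum_le_sum fun u _ => e3 u).trans_eq ?_
      rw [Finset.sum_ite_mem, Finset.univ_inter, Finset.mul_sum]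
    have e3 : ∑ u, ∑ v, (if v ∈ B ∧ f v = f u ∧ G.Adj u v then y u * y v else 0) =
        ∑ u, ∑ v, (if u ∈ B ∧ f v = f u ∧ G.Adj u v then y u * y v else 0) := by
      rw [Finset.sum_comm]
      refine Finset.sum_congr rfl fun u _ => Finset.sum_congr rfl fun v _ => ?_
      simp only [mul_comm (y v), eq_comm (a := f u), G.adj_comm v u]
    simp only [Finset.sum_add_distrib] at e1
    linarith
  have hmiss_ge : c * ∑ u ∈ B, y u ≤ miss := by
    have e1 : miss = ∑ u, y u * ms u := by
      refine Finset.sum_congr rfl fun u _ => ?_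
      rw [hms, Finset.mul_sum, Finset.sum_filter]
    rw [e1, Finset.mul_sum]
    refine le_trans ?_ (Finset.sum_le_sum_of_subset_of_nonneg (Finset.subset_univ B)
      fun u _ _ => mul_nonneg (h.nonneg u) (Finset.sum_nonneg fun v _ => h.nonneg v))
    refine Finset.sum_le_sum fun u hu => ?_
    rw [mul_comm]
    exact mul_le_mul_of_nonneg_left (Finset.mem_filter.1 hu).2 (h.nonneg u)
  have hyB : 0 ≤ ∑ u ∈ B, y u := Finset.sum_nonneg fun u _ => h.nonneg u
  -- Unless y(B) = 0, the gain from inner edges is strictly below the loss c·y(B) from missing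
  -- pairs. This gives both the bound and the equality case.
  have hgap : 2 * (4 * (r * t) * β + 2 * β) < c := by linarith
  refine ⟨?_, fun heq => ?_⟩
  · rw [hid]; nlinarith
  have hyB0 : ∑ u ∈ B, y u = 0 := by
    by_contra hne
    have : 0 < ∑ u ∈ B, y u := lt_of_le_of_ne hyB (Ne.symm hne)
    nlinarith
  rw [hyB0] at hinner_le hmiss_ge
  have hterm_in : ∀ u v, 0 ≤ (if f v = f u ∧ G.Adj u v then y u * y v else 0) := fun u v => by
    have := mul_nonneg (h.nonneg u) (h.nonneg v)
    split_ifs <;> simp [this]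
  have hterm_ms : ∀ u v, 0 ≤ (if f v ≠ f u ∧ ¬ G.Adj u v then y u * y v else 0) := fun u v => by
    have := mul_nonneg (h.nonneg u) (h.nonneg v)
    split_ifs <;> simp [this]
  have hinner0 : inner = 0 := le_antisymm (by linarith)
    (Finset.sum_nonneg fun u _ => Finset.sum_nonneg fun v _ => hterm_in u v)
  have hmiss0 : miss = 0 := by
    linarith
  have hvar00 : ∑ i, (Y i - 1 / r) ^ 2 = 0 := by linarith
  refine ⟨f, fun u v hu hv => ?_, fun i => ?_⟩
  · have hpos := mul_pos hu hv
    constructor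
    · intro huv hf
      have := (Finset.sum_eq_zero_iff_of_nonneg fun u _ =>
        Finset.sum_nonneg fun v _ => hterm_in u v).1 hinner0 u (by simp)
      have := (Finset.sum_eq_zero_iff_of_nonneg fun v _ => hterm_in u v).1 this v (by simp)
      rw [if_pos ⟨hf.symm, huv⟩] at this
      linarith
    · intro hf
      by_contra huv
      have := (Finset.sum_eq_zero_iff_of_nonneg fun u _ =>
        Finset.sum_nonneg fun v _ => hterm_ms u v).1 hmiss0 u (by simp)
      have := (Finset.sum_eq_zero_iff_of_nonneg fun v _ => hterm_ms u v).1 this v (by simp)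
      rw [if_pos ⟨hf.symm, huv⟩] at this
      linarith
  · have := (Finset.sum_eq_zero_iff_of_nonneg fun i _ => sq_nonneg _).1 hvar00 i (by simp)
    have := pow_eq_zero_iff (two_ne_zero) |>.1 this
    linarith

end NearPartite

/-! ### Edge counts and edit distance. -/

open Classical in
lemma sum_adj_eq_two_mul_ncard {V : Type*} [Fintype V] (K : SimpleGraph V) :
    ∑ u, ∑ v, (if K.Adj u v then (1 : ℝ) else 0) = 2 * K.edgeSet.ncard := by
  have h := K.sum_degrees_eq_twice_card_edges
  have h2 : K.edgeSet.ncard = K.edgeFinset.card := by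
    rw [← SimpleGraph.coe_edgeFinset, Set.ncard_coe_finset]
  rw [h2]
  have h3 : ∀ u, ∑ v, (if K.Adj u v then (1 : ℝ) else 0) = K.degree u := by
    intro u
    rw [Finset.sum_boole, ← SimpleGraph.card_neighborFinset_eq_degree]
    congr 2
    ext v
    simp
  simp only [h3]
  exact_mod_cast h

open Classical in
lemma sum_adj_not_adj_le {V : Type*} [Fintype V] (G H : SimpleGraph V) :
    ∑ u, ∑ v, (if G.Adj u v ∧ ¬ H.Adj u v then (1 : ℝ) else 0) ≤ 2 * editDist G H := by
  have h := sum_adj_eq_two_mul_ncard (G \ H)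
  simp only [SimpleGraph.sdiff_adj] at h
  rw [h, SimpleGraph.edgeSet_sdiff, editDist]
  have : (G.edgeSet \ H.edgeSet).ncard ≤ (symmDiff G.edgeSet H.edgeSet).ncard :=
    Set.ncard_le_ncard (by rw [Set.symmDiff_def]; exact Set.subset_union_left) (Set.toFinite _)
  have : ((G.edgeSet \ H.edgeSet).ncard : ℝ) ≤ (symmDiff G.edgeSet H.edgeSet).ncard := by
    exact_mod_cast this
  linarith

lemma editDist_comm {V : Type*} (G H : SimpleGraph V) : editDist G H = editDist H G := by
  rw [editDist, editDist, symmDiff_comm]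

/-! ### The quadratic form and Perron vector of a complete partite graph. -/

section Parts

variable {V : Type*} {r : ℕ} {U : Fin r → Finset V}

lemma sum_eq_sum_parts [Fintype V] (hU : Pairwise (Function.onFun Disjoint U)) (F : V → ℝ)
    (hF : ∀ u, (∀ i, u ∉ U i) → F u = 0) : ∑ u, F u = ∑ i, ∑ u ∈ U i, F u := by
  classical
  rw [← Finset.sum_biUnion (fun i _ j _ hij => hU hij)]
  refine (Finset.sum_subset (Finset.subset_univ _) fun u _ hu => hF u ?_).symm
  simpa using hu

open Classical in
lemma sum_completePartite_adj [Fintype V] (hU : Pairwise (Function.onFun Disjoint U)) (w : V → ℝ) :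
    ∑ u, ∑ v, (if (completePartite U).Adj u v then w u * w v else 0) =
      ∑ i, ∑ j, if i ≠ j then (∑ u ∈ U i, w u) * ∑ v ∈ U j, w v else 0 := by
  have huniq : ∀ {u i j}, u ∈ U i → u ∈ U j → i = j := by
    intro u i j hi hj
    by_contra hij
    exact Finset.disjoint_left.1 (hU hij) hi hj
  rw [sum_eq_sum_parts hU]
  · refine Finset.sum_congr rfl fun i _ => ?_
    have h1 : ∀ u ∈ U i, ∑ v, (if (completePartite U).Adj u v then w u * w v else 0) =
        ∑ j, if i ≠ j then w u * ∑ v ∈ U j, w v else 0 := by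
      intro u hu
      rw [sum_eq_sum_parts hU]
      · refine Finset.sum_congr rfl fun j _ => ?_
        by_cases hij : i = j
        · subst hij
          simp only [ne_eq, not_true_eq_false, if_false]
          refine Finset.sum_eq_zero fun v hv => if_neg ?_
          rintro ⟨-, k, l, hkl, hk, hl⟩
          exact hkl ((huniq hk hu).trans (huniq hv hl))
        · simp only [ne_eq, hij, not_false_eq_true, if_true]
          rw [Finset.mul_sum]
          refine Finset.sum_congr rfl fun v hv => if_pos ⟨?_, i, j, hij, hu, hv⟩
          rintro rfl
          exact hij (huniq hu hv)
      · intro v hv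
        refine if_neg ?_
        rintro ⟨-, k, l, -, -, hl⟩
        exact hv l hl
    rw [Finset.sum_congr rfl h1, Finset.sum_comm]
    refine Finset.sum_congr rfl fun j _ => ?_
    split_ifs
    · rw [Finset.sum_mul]
    · simp
  · intro u hu
    refine Finset.sum_eq_zero fun v _ => if_neg ?_
    rintro ⟨-, k, l, -, hk, -⟩
    exact hu k hk

lemma sum_offDiag_mul (ξ : Fin r → ℝ) :
    ∑ i, ∑ j, (if i ≠ j then ξ i * ξ j else 0) = (∑ i, ξ i) ^ 2 - ∑ i, ξ i ^ 2 := by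
  rw [sq, Finset.sum_mul_sum, ← Finset.sum_sub_distrib]
  refine Finset.sum_congr rfl fun i _ => ?_
  have : ∀ j, (if i ≠ j then ξ i * ξ j else 0) = ξ i * ξ j - if i = j then ξ i * ξ j else 0 := by
    intro j
    split_ifs <;> simp_all
  simp only [this, Finset.sum_sub_distrib, Finset.sum_ite_eq, Finset.mem_univ, if_true]
  ring

lemma sum_offDiag_const (P : ℝ) :
    ∑ i : Fin r, ∑ j : Fin r, (if i ≠ j then P else 0) = r * (r - 1) * P := by
  have h : ∀ i : Fin r, ∑ j : Fin r, (if i ≠ j then P else 0) = (r - 1) * P := by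
    intro i
    have : ∀ j, (if i ≠ j then P else 0) = P - if i = j then P else 0 := by
      intro j
      split_ifs <;> simp_all
    simp only [this, Finset.sum_sub_distrib, Finset.sum_ite_eq, Finset.mem_univ, if_true]
    simp
    ring
  simp only [h]
  simp
  ring

open Classical in
/-- The normalised Perron vector of `completePartite U` when the products of the sizes of any two
parts agree. -/
noncomputable def partVector (U : Fin r → Finset V) (u : V) : ℝ :=
  ∑ i, if u ∈ U i then 1 / √(r * #(U i)) else 0

lemma partVector_of_mem (hU : Pairwise (Function.onFun Disjoint U)) {u : V} {i : Fin r}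
    (hu : u ∈ U i) : partVector U u = 1 / √(r * #(U i)) := by
  rw [partVector, Finset.sum_eq_single i]
  · simp [hu]
  · intro j _ hj
    rw [if_neg]
    intro hj'
    exact Finset.disjoint_left.1 (hU hj) hj' hu
  · simp

lemma partVector_of_notMem {u : V} (hu : ∀ i, u ∉ U i) : partVector U u = 0 := by
  simp [partVector, hu]

lemma partVector_sq_of_mem (hU : Pairwise (Function.onFun Disjoint U)) {u : V} {i : Fin r}
    (hu : u ∈ U i) : partVector U u ^ 2 = 1 / (r * #(U i)) := by
  rw [partVector_of_mem hU hu, div_pow, Real.sq_sqrt (by positivity), one_pow]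

lemma sum_part_partVector_sq (hU : Pairwise (Function.onFun Disjoint U))
    (hne : ∀ i, (U i).Nonempty) (i : Fin r) : ∑ u ∈ U i, partVector U u ^ 2 = 1 / (r : ℝ) := by
  rw [Finset.sum_congr rfl fun u hu => partVector_sq_of_mem hU hu]
  have : (0 : ℝ) < #(U i) := by exact_mod_cast (hne i).card_pos
  rw [Finset.sum_const, nsmul_eq_mul]
  field_simp

lemma sum_partVector_sq [Fintype V] (hr : 0 < r) (hU : Pairwise (Function.onFun Disjoint U))
    (hne : ∀ i, (U i).Nonempty) : ∑ u, partVector U u ^ 2 = 1 := by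
  rw [sum_eq_sum_parts hU _ fun u hu => by rw [partVector_of_notMem hu]; simp]
  have : (0 : ℝ) < r := by exact_mod_cast hr
  simp only [sum_part_partVector_sq hU hne, Finset.sum_const, Finset.card_univ, Fintype.card_fin,
    nsmul_eq_mul]
  field_simp

lemma sum_partVector_mul [Fintype V] (hU : Pairwise (Function.onFun Disjoint U)) (x : V → ℝ) :
    ∑ u, partVector U u * x u = 1 / √r * ∑ i, (∑ u ∈ U i, x u) / √(#(U i)) := by
  rw [sum_eq_sum_parts hU _ fun u hu => by rw [partVector_of_notMem hu]; simp, Finset.mul_sum]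
  refine Finset.sum_congr rfl fun i _ => ?_
  rw [Finset.sum_congr rfl fun u hu => by rw [partVector_of_mem hU hu], ← Finset.mul_sum,
    Real.sqrt_mul (by positivity)]
  ring

/-- A unit vector whose quadratic form on `completePartite U` is nearly maximal is close to
`partVector U`. -/
lemma sum_sub_partVector_sq_le [Fintype V] (hr : 2 ≤ r) (hU : Pairwise (Function.onFun Disjoint U))
    (hne : ∀ i, (U i).Nonempty) {P : ℝ} (hP0 : 0 < P)
    (hP : ∀ i j, i ≠ j → (#(U i) : ℝ) * #(U j) = P)
    {x : V → ℝ} (hx : ∀ v, 0 ≤ x v) (hx1 : ∑ v, x v ^ 2 = 1) {δ : ℝ}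
    (hq : √P * ((r - 1) * (1 - δ)) ≤
      ∑ i, ∑ j, if i ≠ j then (∑ u ∈ U i, x u) * ∑ v ∈ U j, x v else 0) :
    ∑ v, (x v - partVector U v) ^ 2 ≤ 2 * δ := by
  have hr0 : (2 : ℝ) ≤ r := by exact_mod_cast hr
  set ξ : Fin r → ℝ := fun i => (∑ u ∈ U i, x u) / √(#(U i)) with hξ
  have hcard : ∀ i, (0 : ℝ) < #(U i) := fun i => by exact_mod_cast (hne i).card_pos
  -- In the normalised part sums ξ the form becomes √P times that of K_r, which is largest at
  -- constant ξ. It is therefore at most √P (r - 1) s², where s is the inner product of `x` with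
  -- `partVector U`.
  have hQ : (∑ i, ∑ j, if i ≠ j then (∑ u ∈ U i, x u) * ∑ v ∈ U j, x v else 0) =
      √P * ((∑ i, ξ i) ^ 2 - ∑ i, ξ i ^ 2) := by
    rw [← sum_offDiag_mul, Finset.mul_sum]
    refine Finset.sum_congr rfl fun i _ => ?_
    rw [Finset.mul_sum]
    refine Finset.sum_congr rfl fun j _ => ?_
    split_ifs with hij
    · rw [← hP i j hij, Real.sqrt_mul (by positivity), hξ]
      have h1 := (Real.sqrt_pos.2 (hcard i)).ne'
      have h2 := (Real.sqrt_pos.2 (hcard j)).ne'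
      field_simp
    · simp
  rw [hQ] at hq
  have hq' := le_of_mul_le_mul_left hq (Real.sqrt_pos.2 hP0)
  have hcs : (∑ i, ξ i) ^ 2 ≤ r * ∑ i, ξ i ^ 2 := by
    simpa using sq_sum_le_card_mul_sum_sq (s := (Finset.univ : Finset (Fin r))) (f := ξ)
  set s := ∑ u, partVector U u * x u with hs
  have hsξ : s ^ 2 * r = (∑ i, ξ i) ^ 2 := by
    rw [hs, sum_partVector_mul hU, mul_pow, div_pow, Real.sq_sqrt (by positivity)]
    field_simp
    rfl
  have hs2 : 1 - δ ≤ s ^ 2 := by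
    have : (r - 1) * (1 - δ) ≤ (r - 1) * s ^ 2 := by nlinarith
    exact le_of_mul_le_mul_left this (by linarith)
  have hz1 := sum_partVector_sq (by omega) hU hne
  have hexp : ∑ v, (x v - partVector U v) ^ 2 = 2 - 2 * s := by
    have : ∀ v, (x v - partVector U v) ^ 2 =
        x v ^ 2 - 2 * (partVector U v * x v) + partVector U v ^ 2 := fun v => by ring
    simp only [this, Finset.sum_add_distrib, Finset.sum_sub_distrib, ← Finset.mul_sum, hx1, hz1]
    rw [← hs]; ring
  have hpos : 0 ≤ ∑ v, (x v - partVector U v) ^ 2 := Finset.sum_nonneg fun v _ => sq_nonneg _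
  have hs0 : 0 ≤ s := by
    rw [hs]
    refine Finset.sum_nonneg fun v _ => mul_nonneg ?_ (hx v)
    refine Finset.sum_nonneg fun i _ => ?_
    split_ifs <;> positivity
  -- Nonnegativity of 2 - 2s gives s ≤ 1, hence s ≥ s² ≥ 1 - δ.
  nlinarith

end Parts

/-! ### Stability: from edit distance to a near-partite weight. -/

lemma sq_sum_sum_ite_le {V : Type*} [Fintype V] (R : V → V → Prop) [DecidableRel R] (x : V → ℝ) :
    (∑ u, ∑ v, (if R u v then x u * x v else 0)) ^ 2 ≤
      (∑ u, ∑ v, (if R u v then (1 : ℝ) else 0)) *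
        ∑ u, ∑ v, (if R u v then x u ^ 2 * x v ^ 2 else 0) := by
  simp only [← Fintype.sum_prod_type']
  refine le_trans (le_of_eq ?_) ((Finset.sum_mul_sq_le_sq_mul_sq Finset.univ
    (fun p : V × V => if R p.1 p.2 then (1 : ℝ) else 0)
    (fun p : V × V => if R p.1 p.2 then x p.1 * x p.2 else 0)).trans (le_of_eq ?_))
  · congr 1
    refine Finset.sum_congr rfl fun p _ => ?_
    split_ifs <;> simp
  · congr 1
    · refine Finset.sum_congr rfl fun p _ => ?_
      split_ifs <;> simp
    · refine Finset.sum_congr rfl fun p _ => ?_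
      split_ifs <;> ring

/-- Factor x² - z² = (x - z)(x + z) and apply Cauchy–Schwarz with ‖x + z‖² ≤ 4. This turns closeness
in norm into closeness of the weights in total variation. -/
lemma sum_abs_sq_sub_sq_le {V : Type*} [Fintype V] {x z : V → ℝ} (hx : ∑ v, x v ^ 2 = 1)
    (hz : ∑ v, z v ^ 2 = 1) {ρ : ℝ} (hρ : 0 ≤ ρ) (h : ∑ v, (x v - z v) ^ 2 ≤ ρ ^ 2) :
    ∑ v, |x v ^ 2 - z v ^ 2| ≤ 2 * ρ := by
  have h1 := Finset.sum_mul_sq_le_sq_mul_sq Finset.univ (fun v => |x v - z v|)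
    (fun v => |x v + z v|)
  have h2 : ∀ v, |x v - z v| * |x v + z v| = |x v ^ 2 - z v ^ 2| := fun v => by
    rw [← abs_mul]; ring_nf
  simp only [h2, sq_abs] at h1
  have h3 : ∑ v, (x v + z v) ^ 2 ≤ 4 := by
    have : ∑ v, (x v + z v) ^ 2 ≤ ∑ v, (2 * x v ^ 2 + 2 * z v ^ 2) :=
      Finset.sum_le_sum fun v _ => by nlinarith [sq_nonneg (x v - z v)]
    rw [Finset.sum_add_distrib, ← Finset.mul_sum, ← Finset.mul_sum, hx, hz] at this
    linarith
  refine abs_le_of_sq_le_sq' ?_ (by positivity) |>.2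
  have h4 : 0 ≤ ∑ v, (x v - z v) ^ 2 := Finset.sum_nonneg fun v _ => sq_nonneg _
  nlinarith

lemma two_mul_ncard_edgeSet_completePartite {V : Type*} [Fintype V] {r : ℕ} {U : Fin r → Finset V}
    (hU : Pairwise (Function.onFun Disjoint U)) {P : ℝ}
    (hP : ∀ i j, i ≠ j → (#(U i) : ℝ) * #(U j) = P) :
    2 * ((completePartite U).edgeSet.ncard : ℝ) = r * (r - 1) * P := by
  have := sum_completePartite_adj hU (fun _ => 1)
  simp only [mul_one, Finset.sum_const, nsmul_eq_mul] at this
  rw [← sum_adj_eq_two_mul_ncard, this, ← sum_offDiag_const P]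
  refine Finset.sum_congr rfl fun i _ => Finset.sum_congr rfl fun j _ => ?_
  split_ifs with hij
  · rw [← hP i j hij]
  · rfl

open Classical in
/-- If `G` is close to a complete `r`-partite graph, then a unit vector with quadratic form at least
`√((1 - 1 / r) * 2m)` is close to `partVector U`. -/
lemma sum_sub_partVector_sq_le_of_le_sq {V : Type*} [Fintype V] {r : ℕ} {G : SimpleGraph V}
    {U : Fin r → Finset V} {m : ℕ} (hr : 2 ≤ r) (hm : G.edgeSet.ncard = m)
    (hU : Pairwise (Function.onFun Disjoint U)) {κ : ℝ} (hκ0 : 0 < κ) (hκ1 : 8 * κ ≤ 1)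
    (hne : ∀ i, (U i).Nonempty) {P : ℝ} (hP0 : 0 < P)
    (hP : ∀ i j, i ≠ j → (#(U i) : ℝ) * #(U j) = P)
    (hedit : (editDist G (completePartite U) : ℝ) ≤ κ ^ 2 * m)
    {x : V → ℝ} (hx : ∀ v, 0 ≤ x v) (hx1 : ∑ v, x v ^ 2 = 1)
    (hq : (1 - 1 / (r : ℝ)) * (2 * m) ≤
      (∑ u, ∑ v, (if G.Adj u v then x u * x v else 0)) ^ 2) :
    ∑ v, (x v - partVector U v) ^ 2 ≤ 8 * κ ∧
    ∑ u, ∑ v, (if (completePartite U).Adj u v ∧ ¬ G.Adj u v then (1 : ℝ) else 0) ≤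
      2 * κ ^ 2 * (r ^ 2 * P) := by
  have hr0 : (2 : ℝ) ≤ r := by exact_mod_cast hr
  have hm0 : (0 : ℝ) ≤ m := by positivity
  have hq0 : 0 ≤ ∑ u, ∑ v, (if G.Adj u v then x u * x v else 0) :=
    Finset.sum_nonneg fun u _ => Finset.sum_nonneg fun v _ => by
      split_ifs
      · exact mul_nonneg (hx u) (hx v)
      · exact le_rfl
  set H := completePartite U with hH
  have cG : ∑ u, ∑ v, (if G.Adj u v then (1 : ℝ) else 0) = 2 * m := by
    rw [sum_adj_eq_two_mul_ncard, hm]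
  have cH : ∑ u, ∑ v, (if H.Adj u v then (1 : ℝ) else 0) = r * (r - 1) * P :=
    (sum_adj_eq_two_mul_ncard H).trans (two_mul_ncard_edgeSet_completePartite hU hP)
  have cGH : ∑ u, ∑ v, (if G.Adj u v ∧ ¬ H.Adj u v then (1 : ℝ) else 0) ≤ κ ^ 2 * (2 * m) := by
    have := sum_adj_not_adj_le G H
    linarith
  have cHG : ∑ u, ∑ v, (if H.Adj u v ∧ ¬ G.Adj u v then (1 : ℝ) else 0) ≤ κ ^ 2 * (2 * m) := by
    have := sum_adj_not_adj_le H G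
    rw [editDist_comm] at this
    linarith
  have hsplit : ∀ (A B : SimpleGraph V) (w : V → V → ℝ), (∀ u v, 0 ≤ w u v) →
      ∑ u, ∑ v, (if A.Adj u v then w u v else 0) ≤ ∑ u, ∑ v, (if B.Adj u v then w u v else 0) +
        ∑ u, ∑ v, (if A.Adj u v ∧ ¬ B.Adj u v then w u v else 0) := by
    intro A B w hw
    simp only [← Finset.sum_add_distrib]
    refine Finset.sum_le_sum fun u _ => Finset.sum_le_sum fun v _ => ?_
    have := hw u v
    by_cases h1 : A.Adj u v <;> by_cases h2 : B.Adj u v <;> simp [h1, h2, this]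
  have hPm : r * (r - 1) * P ≤ 2 * m * (1 + κ ^ 2) := by
    have := hsplit H G (fun _ _ => 1) (fun _ _ => zero_le_one)
    linarith
  have hmP : 2 * m * (1 - κ ^ 2) ≤ r * (r - 1) * P := by
    have := hsplit G H (fun _ _ => 1) (fun _ _ => zero_le_one)
    linarith
  set a := √((1 - 1 / (r : ℝ)) * (2 * m)) with ha
  have hrinv : 1 / (r : ℝ) ≤ 1 / 2 := one_div_le_one_div_of_le (by norm_num) hr0
  have ha2 : a ^ 2 = (1 - 1 / (r : ℝ)) * (2 * m) := by
    rw [ha, Real.sq_sqrt]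
    exact mul_nonneg (by linarith) (by linarith)
  have ha0 : 0 ≤ a := Real.sqrt_nonneg _
  have haq : a ≤ ∑ u, ∑ v, (if G.Adj u v then x u * x v else 0) := by
    refine abs_le_of_sq_le_sq' ?_ hq0 |>.2
    rw [ha2]; exact hq
  have hall : ∑ u, ∑ v, x u ^ 2 * x v ^ 2 = 1 := by
    rw [← Finset.sum_mul_sum, hx1, one_mul]
  -- Few edges of G lie outside H, so by Cauchy–Schwarz they carry little of the form. The
  -- comparison with `a` uses a² ≥ m, which holds because r ≥ 2.
  have hdiff : ∑ u, ∑ v, (if G.Adj u v ∧ ¬ H.Adj u v then x u * x v else 0) ≤ 2 * κ * a := by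
    refine abs_le_of_sq_le_sq' ?_ (by positivity) |>.2
    refine (sq_sum_sum_ite_le (fun u v => G.Adj u v ∧ ¬ H.Adj u v) x).trans ?_
    have h1 : ∑ u, ∑ v, (if G.Adj u v ∧ ¬ H.Adj u v then x u ^ 2 * x v ^ 2 else 0) ≤ 1 := by
      rw [← hall]
      refine Finset.sum_le_sum fun u _ => Finset.sum_le_sum fun v _ => ?_
      split_ifs
      · exact le_rfl
      · positivity
    have h2 : 0 ≤ ∑ u, ∑ v, (if G.Adj u v ∧ ¬ H.Adj u v then (1 : ℝ) else 0) :=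
      Finset.sum_nonneg fun u _ => Finset.sum_nonneg fun v _ => by split_ifs <;> simp
    refine (mul_le_of_le_one_right h2 h1).trans (cGH.trans ?_)
    rw [mul_pow, mul_pow, ha2]
    have : 2 * (m : ℝ) ≤ 2 ^ 2 * ((1 - 1 / r) * (2 * m)) := by nlinarith
    nlinarith [sq_nonneg κ]
  have hHq := sum_completePartite_adj hU x
  have hGx := hsplit G H (fun u v => x u * x v) (fun u v => mul_nonneg (hx u) (hx v))
  rw [← hH] at hHq
  rw [hHq] at hGx
  -- The left side is the maximum of the form of H. It exceeds `a` by a factor of at most 1 + κ,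
  -- because 2e(H) ≤ 2m(1 + κ²).
  have haP : (r - 1) * √P ≤ a * (1 + κ) := by
    refine abs_le_of_sq_le_sq' ?_ (by positivity) |>.2
    rw [mul_pow, Real.sq_sqrt hP0.le, mul_pow, ha2]
    have e1 : ((r : ℝ) - 1) ^ 2 * P = (1 - 1 / r) * (r * (r - 1) * P) := by
      field_simp
    rw [e1, mul_assoc (1 - 1 / (r : ℝ))]
    refine mul_le_mul_of_nonneg_left (hPm.trans ?_) (by linarith)
    refine mul_le_mul_of_nonneg_left ?_ (by linarith)
    nlinarith
  constructor
  · have := sum_sub_partVector_sq_le hr hU hne hP0 hP hx hx1 (δ := 4 * κ) ?_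
    · linarith
    · have e1 : a * (1 - 2 * κ) ≤
          ∑ i, ∑ j, if i ≠ j then (∑ u ∈ U i, x u) * ∑ v ∈ U j, x v else 0 := by
        linarith
      refine le_trans ?_ e1
      have e2 : (1 - 4 * κ) * (1 + κ) ≤ 1 - 2 * κ := by nlinarith
      have e3 : √P * ((r - 1) * (1 - 4 * κ)) ≤ (a * (1 + κ)) * (1 - 4 * κ) := by
        have := mul_le_mul_of_nonneg_right haP (by linarith : 0 ≤ 1 - 4 * κ)
        linarith
      refine e3.trans ?_
      have := mul_le_mul_of_nonneg_left e2 ha0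
      linarith
  · refine cHG.trans ?_
    have hk : κ ^ 2 ≤ 1 / 2 := by nlinarith
    have e1 : 2 * (m : ℝ) * (1 / 2) ≤ 2 * m * (1 - κ ^ 2) :=
      mul_le_mul_of_nonneg_left (by linarith) (by linarith)
    have e2 : r * (r - 1) * P ≤ r ^ 2 * P := mul_le_mul_of_nonneg_right (by linarith) hP0.le
    have e3 : 2 * (m : ℝ) ≤ 2 * (r ^ 2 * P) := by linarith
    have := mul_le_mul_of_nonneg_left e3 (sq_nonneg κ)
    linarith

open Classical in
/-- A graph `G` close to a complete `r`-partite graph is nearly partite for the weight `x ^ 2`, where `x`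
is a unit vector with quadratic form at least `√((1 - 1 / r) * 2m)`. -/
lemma nearPartite_of_le_sq {V : Type*} [Fintype V] {r : ℕ} {G : SimpleGraph V}
    {U : Fin r → Finset V} {m : ℕ} (hr : 2 ≤ r) (hm : G.edgeSet.ncard = m)
    (hU : Pairwise (Function.onFun Disjoint U)) {β ρ κ : ℝ} (hβ0 : 0 < β) (hβ1 : β ≤ 1)
    (hρ : 5 * ρ = β ^ 2) (hκ : 8 * κ = ρ ^ 2)
    (hcard : ∀ i, 2 / β ≤ #(U i)) {P : ℝ} (hP : ∀ i j, i ≠ j → (#(U i) : ℝ) * #(U j) = P)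
    (hedit : (editDist G (completePartite U) : ℝ) ≤ κ ^ 2 * m)
    {x : V → ℝ} (hx : ∀ v, 0 ≤ x v) (hx1 : ∑ v, x v ^ 2 = 1)
    (hq : (1 - 1 / (r : ℝ)) * (2 * m) ≤
      (∑ u, ∑ v, (if G.Adj u v then x u * x v else 0)) ^ 2) :
    NearPartite G (fun v => x v ^ 2) U β := by
  have hr0 : (2 : ℝ) ≤ r := by exact_mod_cast hr
  have hρ0 : 0 < ρ := by nlinarith
  have hκ0 : 0 < κ := by nlinarith
  have hρβ : 5 * ρ ≤ β := by nlinarith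
  have hρ1 : ρ ≤ 1 / 5 := by linarith
  have hκρ : 8 * κ ≤ ρ := by nlinarith
  have hc0 : ∀ i, (0 : ℝ) < #(U i) := fun i => lt_of_lt_of_le (by positivity) (hcard i)
  have hne : ∀ i, (U i).Nonempty := fun i => Finset.card_pos.1 (by exact_mod_cast hc0 i)
  have hP0 : 0 < P := by
    rw [← hP ⟨0, by omega⟩ ⟨1, by omega⟩ (by simp)]
    exact mul_pos (hc0 _) (hc0 _)
  obtain ⟨hclose, hHG⟩ := sum_sub_partVector_sq_le_of_le_sq hr hm hU hκ0 (by linarith) hne hP0 hP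
    hedit hx hx1 hq
  rw [hκ] at hclose
  set z := partVector U with hz
  have hz1 : ∑ v, z v ^ 2 = 1 := sum_partVector_sq (by omega) hU hne
  have hTV := sum_abs_sq_sub_sq_le hx1 hz1 hρ0.le hclose
  -- Error budget: 8κ = ρ² puts x² and z² within 2ρ in total variation, and β² = 5ρ pays for two
  -- such replacements plus 2κ² of missing pairs. Parts of size at least 2/β keep z² below β/4.
  refine ⟨fun v => sq_nonneg _, hx1, hβ0, fun v => ?_, hU, fun i => ?_, ?_⟩
  · have e1 : (x v - z v) ^ 2 ≤ ρ ^ 2 :=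
      (Finset.single_le_sum (f := fun v => (x v - z v) ^ 2) (fun v _ => sq_nonneg _)
        (Finset.mem_univ v)).trans hclose
    have e2 : z v ^ 2 ≤ β / 4 := by
      by_cases hv : ∃ i, v ∈ U i
      · obtain ⟨i, hi⟩ := hv
        rw [hz, partVector_sq_of_mem hU hi, div_le_iff₀ (mul_pos (by linarith) (hc0 i))]
        have := hcard i
        rw [div_le_iff₀ hβ0] at this
        nlinarith
      · rw [hz, partVector_of_notMem (by simpa using hv)]
        nlinarith
    have e3 : x v ^ 2 ≤ 2 * z v ^ 2 + 2 * (x v - z v) ^ 2 := by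
      nlinarith [sq_nonneg (x v - 2 * z v)]
    nlinarith
  · have e1 : ∑ v ∈ U i, |x v ^ 2 - z v ^ 2| ≤ 2 * ρ :=
      (Finset.sum_le_sum_of_subset_of_nonneg (Finset.subset_univ _)
        fun v _ _ => abs_nonneg _).trans hTV
    have e2 : ∑ v ∈ U i, z v ^ 2 = 1 / (r : ℝ) := sum_part_partVector_sq hU hne i
    have e3 : ∑ v ∈ U i, (z v ^ 2 - |x v ^ 2 - z v ^ 2|) ≤ ∑ v ∈ U i, x v ^ 2 :=
      Finset.sum_le_sum fun v _ => by linarith [neg_abs_le (x v ^ 2 - z v ^ 2)]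
    rw [Finset.sum_sub_distrib] at e3
    linarith
  -- Replace x² by z² one factor at a time. The product z_u² z_v² is the same for all edges of H, so
  -- what remains is a multiple of the number of missing edges.
  · have e1 : ∀ u v, (if (completePartite U).Adj u v ∧ ¬ G.Adj u v then x u ^ 2 * x v ^ 2 else 0) ≤
        1 / (r ^ 2 * P) * (if (completePartite U).Adj u v ∧ ¬ G.Adj u v then 1 else 0) +
          (|x u ^ 2 - z u ^ 2| * x v ^ 2 + z u ^ 2 * |x v ^ 2 - z v ^ 2|) := by
      intro u v
      have e0 : 0 ≤ |x u ^ 2 - z u ^ 2| * x v ^ 2 + z u ^ 2 * |x v ^ 2 - z v ^ 2| := by positivity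
      split_ifs with huv
      · obtain ⟨-, i, j, hij, hu, hv⟩ := huv.1
        have e2 : z u ^ 2 * z v ^ 2 = 1 / (r ^ 2 * P) := by
          rw [hz, partVector_sq_of_mem hU hu, partVector_sq_of_mem hU hv, ← hP i j hij]
          have := (hc0 i).ne'
          have := (hc0 j).ne'
          field_simp
        rw [← e2]
        have e3 := mul_le_mul_of_nonneg_right (le_abs_self (x u ^ 2 - z u ^ 2)) (sq_nonneg (x v))
        have e4 := mul_le_mul_of_nonneg_left (le_abs_self (x v ^ 2 - z v ^ 2)) (sq_nonneg (z u))
        linarith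
      · simpa using e0
    have e2 := Finset.sum_le_sum fun u (_ : u ∈ Finset.univ) =>
      Finset.sum_le_sum fun v (_ : v ∈ Finset.univ) => e1 u v
    refine e2.trans ?_
    simp only [Finset.sum_add_distrib, ← Finset.mul_sum, ← Finset.sum_mul, hx1, hz1]
    have e3 : 1 / (r ^ 2 * P) *
        ∑ u, ∑ v, (if (completePartite U).Adj u v ∧ ¬ G.Adj u v then (1 : ℝ) else 0) ≤ 2 * κ ^ 2 := by
      rw [one_div, inv_mul_le_iff₀ (by positivity)]
      linarith
    nlinarith

/-! ### Degrees and part sizes in complete partite graphs. -/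

section Partite

variable {V : Type*} [Fintype V] {r : ℕ} {U : Fin r → Finset V}

open Classical in
lemma neighborFinset_completePartite (hU : Pairwise (Function.onFun Disjoint U)) {v : V} {i : Fin r}
    (hv : v ∈ U i) :
    (completePartite U).neighborFinset v = (Finset.univ.erase i).biUnion U := by
  have huniq : ∀ {u i j}, u ∈ U i → u ∈ U j → i = j := by
    intro u i j hi hj
    by_contra hij
    exact Finset.disjoint_left.1 (hU hij) hi hj
  ext w
  simp only [SimpleGraph.mem_neighborFinset, Finset.mem_biUnion, Finset.mem_erase, Finset.mem_univ,
    and_true]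
  constructor
  · rintro ⟨-, k, l, hkl, hk, hl⟩
    exact ⟨l, fun h => hkl ((huniq hk hv).trans h.symm), hl⟩
  · rintro ⟨j, hj, hw⟩
    refine ⟨?_, i, j, hj.symm, hv, hw⟩
    rintro rfl
    exact hj (huniq hw hv)

lemma ncard_neighborSet_completePartite (hU : Pairwise (Function.onFun Disjoint U)) {v : V}
    {i : Fin r} (hv : v ∈ U i) :
    ((completePartite U).neighborSet v).ncard + #(U i) = ∑ j, #(U j) := by
  classical
  rw [← SimpleGraph.coe_neighborFinset, Set.ncard_coe_finset, neighborFinset_completePartite hU hv,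
    Finset.card_biUnion fun _ _ _ _ h => hU h, Finset.sum_erase_add _ _ (Finset.mem_univ i)]

/-- In the two cases of the theorem, the product of the sizes of two parts is constant. -/
lemma exists_card_mul_card_eq (hr : 2 ≤ r) (hU : Pairwise (Function.onFun Disjoint U))
    (hne : ∀ i, (U i).Nonempty)
    (hreg : 3 ≤ r → RegularOn (completePartite U) (⋃ i, (U i : Set V))) :
    ∃ P : ℝ, 0 < P ∧ ∀ i j, i ≠ j → (#(U i) : ℝ) * #(U j) = P := by
  have hpos : ∀ i, (0 : ℝ) < #(U i) := fun i => by exact_mod_cast (hne i).card_pos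
  refine ⟨#(U ⟨0, by omega⟩) * #(U ⟨1, by omega⟩), mul_pos (hpos _) (hpos _), ?_⟩
  by_cases h3 : 3 ≤ r
  · obtain ⟨d, hd⟩ := hreg h3
    have heq : ∀ i j, #(U i) = #(U j) := by
      intro i j
      obtain ⟨u, hu⟩ := hne i
      obtain ⟨v, hv⟩ := hne j
      have h1 := ncard_neighborSet_completePartite hU hu
      have h2 := ncard_neighborSet_completePartite hU hv
      rw [hd u (Set.mem_iUnion.2 ⟨i, hu⟩)] at h1
      rw [hd v (Set.mem_iUnion.2 ⟨j, hv⟩)] at h2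
      omega
    intro i j _
    rw [heq i ⟨0, by omega⟩, heq j ⟨1, by omega⟩]
  · obtain rfl : r = 2 := by omega
    intro i j hij
    fin_cases i <;> fin_cases j
    · exact absurd rfl hij
    · rfl
    · exact mul_comm _ _
    · exact absurd rfl hij

end Partite

/-! ### The spectral radius and quadratic forms. -/

section Lam

open Classical in
lemma isHermitian_adjMatrix {V : Type*} (G : SimpleGraph V) : (G.adjMatrix ℝ).IsHermitian := by
  have h := G.isSymm_adjMatrix (α := ℝ)
  rw [Matrix.IsHermitian, Matrix.conjTranspose_eq_transpose_of_trivial]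
  exact h

variable {V : Type*} [Fintype V]

lemma lam_nonneg (G : SimpleGraph V) : 0 ≤ lam G := ENNReal.toReal_nonneg

open Classical in
lemma spectralRadius_adjMatrix_ne_top (G : SimpleGraph V) :
    spectralRadius ℝ (G.adjMatrix ℝ) ≠ ⊤ := by
  have hA := isHermitian_adjMatrix G
  obtain ⟨C, hC⟩ := (Set.finite_range fun j => ‖hA.eigenvalues j‖₊).bddAbove
  refine ne_top_of_le_ne_top (ENNReal.coe_ne_top (r := C)) (iSup₂_le fun k hk => ?_)
  rw [hA.spectrum_real_eq_range_eigenvalues] at hk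
  obtain ⟨j, rfl⟩ := hk
  exact_mod_cast hC ⟨j, rfl⟩

open Classical in
lemma le_lam {G : SimpleGraph V} {μ : ℝ} {z : V → ℝ} (hz : z ≠ 0)
    (h : (G.adjMatrix ℝ).mulVec z = μ • z) : μ ≤ lam G := by
  have h1 : μ ∈ spectrum ℝ (G.adjMatrix ℝ) := by
    rw [← Matrix.spectrum_toLin', ← Module.End.hasEigenvalue_iff_mem_spectrum]
    refine Module.End.hasEigenvalue_of_hasEigenvector (x := z) ⟨?_, hz⟩
    rw [Module.End.mem_eigenspace_iff, Matrix.toLin'_apply, h]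
  have h2 : (‖μ‖₊ : ENNReal) ≤ spectralRadius ℝ (G.adjMatrix ℝ) :=
    le_iSup₂ (f := fun k (_ : k ∈ spectrum ℝ (G.adjMatrix ℝ)) => (‖k‖₊ : ENNReal)) μ h1
  have h3 := ENNReal.toReal_mono (spectralRadius_adjMatrix_ne_top G) h2
  refine le_trans ?_ h3
  simpa using le_abs_self μ

-- Take entrywise absolute values of a unit eigenvector for an eigenvalue of maximum modulus. This
-- covers a negative eigenvalue of maximum modulus and avoids Perron–Frobenius.
open Classical in
lemma exists_unit_vector_lam_le [Nonempty V] (G : SimpleGraph V) :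
    ∃ x : V → ℝ, (∀ v, 0 ≤ x v) ∧ ∑ v, x v ^ 2 = 1 ∧
      lam G ≤ ∑ u, ∑ v, (if G.Adj u v then x u * x v else 0) := by
  have hA := isHermitian_adjMatrix G
  obtain ⟨j, hj⟩ := Finite.exists_max fun j => |hA.eigenvalues j|
  have h1 : lam G ≤ |hA.eigenvalues j| := by
    refine ENNReal.toReal_le_of_le_ofReal (abs_nonneg _) (iSup₂_le fun k hk => ?_)
    rw [hA.spectrum_real_eq_range_eigenvalues] at hk
    obtain ⟨i, rfl⟩ := hk
    rw [← Real.norm_eq_abs, ofReal_norm]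
    have : ‖hA.eigenvalues i‖₊ ≤ ‖hA.eigenvalues j‖₊ := hj i
    exact_mod_cast this
  set w : V → ℝ := (hA.eigenvectorBasis j).ofLp with hw
  have hw1 : ∑ v, w v ^ 2 = 1 := by
    rw [hw, ← EuclideanSpace.real_norm_sq_eq, OrthonormalBasis.norm_eq_one, one_pow]
  refine ⟨fun v => |w v|, fun v => abs_nonneg _, by simpa using hw1, h1.trans ?_⟩
  have h2 := hA.mulVec_eigenvectorBasis j
  rw [← hw] at h2
  have h3 : hA.eigenvalues j = ∑ u, ∑ v, (if G.Adj u v then w u * w v else 0) := by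
    calc hA.eigenvalues j = ∑ u, w u * (hA.eigenvalues j • w) u := by
          simp only [Pi.smul_apply, smul_eq_mul]
          have : ∀ u, w u * (hA.eigenvalues j * w u) = hA.eigenvalues j * w u ^ 2 :=
            fun u => by ring
          simp only [this, ← Finset.mul_sum, hw1, mul_one]
      _ = _ := by
          rw [← h2]
          refine Finset.sum_congr rfl fun u _ => ?_
          rw [Matrix.mulVec, dotProduct, Finset.mul_sum]
          refine Finset.sum_congr rfl fun v _ => ?_
          rw [SimpleGraph.adjMatrix_apply]
          split_ifs <;> simp
  rw [h3]
  refine (Finset.abs_sum_le_sum_abs _ _).trans (Finset.sum_le_sum fun u _ => ?_)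
  refine (Finset.abs_sum_le_sum_abs _ _).trans (Finset.sum_le_sum fun v _ => ?_)
  split_ifs
  · rw [abs_mul]
  · simp

/-- `partVector U` is an eigenvector: its sum over U_j is √(|U_j|/r), which by |U_i||U_j| = P is √P
times its value on U_i, and each vertex of U_i sees r - 1 such parts. -/
lemma le_lam_completePartite {r : ℕ} {U : Fin r → Finset V} (hr : 2 ≤ r)
    (hU : Pairwise (Function.onFun Disjoint U)) (hne : ∀ i, (U i).Nonempty) {P : ℝ}
    (hP : ∀ i j, i ≠ j → (#(U i) : ℝ) * #(U j) = P) :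
    (r - 1) * √P ≤ lam (completePartite U) := by
  classical
  refine le_lam (z := partVector U) ?_ ?_
  · intro h
    have := sum_partVector_sq (by omega) hU hne
    simp [h] at this
  · ext v
    rw [SimpleGraph.adjMatrix_mulVec_apply, Pi.smul_apply, smul_eq_mul]
    by_cases hv : ∃ i, v ∈ U i
    · obtain ⟨i, hi⟩ := hv
      rw [neighborFinset_completePartite hU hi, Finset.sum_biUnion fun _ _ _ _ h => hU h]
      have hpos : ∀ i, (0 : ℝ) < #(U i) := fun i => by exact_mod_cast (hne i).card_pos
      have h1 : ∀ j ∈ Finset.univ.erase i, ∑ v ∈ U j, partVector U v = √P * partVector U v := by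
        intro j hj
        rw [Finset.sum_congr rfl fun u hu => partVector_of_mem hU hu, partVector_of_mem hU hi,
          Finset.sum_const, nsmul_eq_mul, ← hP i j (Finset.ne_of_mem_erase hj).symm,
          Real.sqrt_mul (by positivity), Real.sqrt_mul (by positivity),
          Real.sqrt_mul (by positivity)]
        have := Real.sqrt_pos.2 (hpos i)
        have := Real.sqrt_pos.2 (hpos j)
        have : (0 : ℝ) < √r := Real.sqrt_pos.2 (by positivity)
        field_simp
        rw [Real.sq_sqrt (hpos j).le]
      rw [Finset.sum_congr rfl h1, Finset.sum_const, Finset.card_erase_of_mem (Finset.mem_univ _),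
        Finset.card_univ, Fintype.card_fin, nsmul_eq_mul, Nat.cast_sub (by omega)]
      push_cast
      ring
    · rw [partVector_of_notMem (by simpa using hv), mul_zero]
      refine Finset.sum_eq_zero fun u hu => ?_
      rw [SimpleGraph.mem_neighborFinset] at hu
      obtain ⟨-, i, _, -, hi, -⟩ := hu
      exact absurd ⟨i, hi⟩ hv

end Lam

/-! ### The equality case. -/

open Classical in
lemma sum_adj_mul_sub_sq {V : Type*} [Fintype V] (G : SimpleGraph V) (x : V → ℝ) (c : ℝ) :
    ∑ u, ∑ v, (if G.Adj u v then (x u * x v - c) ^ 2 else 0) =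
      ∑ u, ∑ v, (if G.Adj u v then x u ^ 2 * x v ^ 2 else 0) -
        2 * c * ∑ u, ∑ v, (if G.Adj u v then x u * x v else 0) +
          c ^ 2 * (2 * G.edgeSet.ncard) := by
  rw [← sum_adj_eq_two_mul_ncard]
  simp only [Finset.mul_sum, ← Finset.sum_sub_distrib, ← Finset.sum_add_distrib]
  refine Finset.sum_congr rfl fun u _ => Finset.sum_congr rfl fun v _ => ?_
  split_ifs <;> ring

/-- A complete partite graph is regular if the entries of a positive vector with equal weights on
the parts have a constant product over the edges and there are at least three parts. -/
lemma regularOn_completePartite {V : Type*} [Fintype V] {r : ℕ} (hr : 3 ≤ r) {W : Fin r → Finset V}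
    (hW : Pairwise (Function.onFun Disjoint W)) (hne : ∀ i, (W i).Nonempty) {x : V → ℝ} {c b : ℝ}
    (hx : ∀ i, ∀ v ∈ W i, 0 < x v)
    (hc : ∀ u v, (completePartite W).Adj u v → x u * x v = c)
    (hb : ∀ i, ∑ v ∈ W i, x v ^ 2 = b) :
    RegularOn (completePartite W) (⋃ i, (W i : Set V)) := by
  have hadj : ∀ {i j u v}, i ≠ j → u ∈ W i → v ∈ W j → (completePartite W).Adj u v := by
    intro i j u v hij hu hv
    refine ⟨?_, i, j, hij, hu, hv⟩
    rintro rfl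
    exact Finset.disjoint_left.1 (hW hij) hu hv
  have hconst : ∀ {i j u v}, u ∈ W i → v ∈ W j → x u = x v := by
    intro i j u v hu hv
    -- A third part is what forces `x` to be constant: comparing with a common neighbour cancels.
    -- With two parts this fails, and unbalanced complete bipartite graphs are indeed extremal.
    obtain ⟨k, hk⟩ : ∃ k, k ∉ ({i, j} : Finset (Fin r)) := by
      by_contra! h
      have h1 : (Finset.univ : Finset (Fin r)) ⊆ {i, j} := fun k _ => h k
      have h2 := Finset.card_le_card h1
      have h3 : #({i, j} : Finset (Fin r)) ≤ 2 := Finset.card_le_two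
      rw [Finset.card_univ, Fintype.card_fin] at h2
      omega
    simp only [Finset.mem_insert, Finset.mem_singleton, not_or] at hk
    obtain ⟨w, hw⟩ := hne k
    have h1 := hc u w (hadj (Ne.symm hk.1) hu hw)
    have h2 := hc v w (hadj (Ne.symm hk.2) hv hw)
    exact mul_right_cancel₀ (hx k w hw).ne' (h1.trans h2.symm)
  have hcard : ∀ i j, #(W i) = #(W j) := by
    intro i j
    obtain ⟨u, hu⟩ := hne i
    have h1 : ∀ k, (#(W k) : ℝ) * x u ^ 2 = b := by
      intro k
      rw [← hb k, Finset.sum_congr rfl fun v hv => by rw [← hconst hu hv], Finset.sum_const,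
        nsmul_eq_mul]
    have h2 := mul_right_cancel₀ (pow_pos (hx i u hu) 2).ne' ((h1 i).trans (h1 j).symm)
    exact_mod_cast h2
  refine ⟨∑ j, #(W j) - #(W ⟨0, by omega⟩), fun v hv => ?_⟩
  obtain ⟨i, hi⟩ := Set.mem_iUnion.1 hv
  have h1 := ncard_neighborSet_completePartite hW (Finset.mem_coe.1 hi)
  have h2 := hcard i ⟨0, by omega⟩
  omega

open Classical in
/-- The edge version of the weighted Turán bound, with the structure of extremal graphs. -/
lemma NearPartite.eq_and_isCompletePartite {V : Type*} [Fintype V] {r t : ℕ} {G : SimpleGraph V}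
    {U : Fin r → Finset V} {β : ℝ} {x : V → ℝ} {m : ℕ}
    (h : NearPartite G (fun v => x v ^ 2) U β) (hr : 2 ≤ r) (ht : 2 ≤ t)
    (hβ : 100 * r * (r * t) * β = 1) (hfree : (blowupPlus r t).Free G)
    (hm : G.edgeSet.ncard = m) (hm0 : 0 < m) (hx : ∀ v, 0 ≤ x v)
    (hq : (1 - 1 / (r : ℝ)) * (2 * m) ≤
      (∑ u, ∑ v, (if G.Adj u v then x u * x v else 0)) ^ 2) :
    (∑ u, ∑ v, (if G.Adj u v then x u * x v else 0)) ^ 2 = (1 - 1 / (r : ℝ)) * (2 * m) ∧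
      IsCompletePartite r G ∧ (3 ≤ r → IsRegularCompletePartite r G) := by
  have hr0 : (2 : ℝ) ≤ r := by exact_mod_cast hr
  have hrinv : 1 / (r : ℝ) ≤ 1 / 2 := one_div_le_one_div_of_le (by norm_num) hr0
  have hm1 : (0 : ℝ) < m := by exact_mod_cast hm0
  obtain ⟨hS, hSeq⟩ := h.sum_adj_le hr ht hβ hfree
  set q := ∑ u, ∑ v, (if G.Adj u v then x u * x v else 0) with hqdef
  set S := ∑ u, ∑ v, (if G.Adj u v then x u ^ 2 * x v ^ 2 else 0) with hSdef
  have hqnn : 0 ≤ q := Finset.sum_nonneg fun u _ => Finset.sum_nonneg fun v _ => by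
    split_ifs
    · exact mul_nonneg (hx u) (hx v)
    · exact le_rfl
  have hq0 : 0 < q := by
    refine lt_of_le_of_ne hqnn fun h0 => ?_
    rw [← h0] at hq
    nlinarith
  have hcs : q ^ 2 ≤ 2 * m * S := by
    have := sq_sum_sum_ite_le G.Adj x
    rwa [sum_adj_eq_two_mul_ncard, hm] at this
  -- The assumed lower bound on q² and Cauchy–Schwarz squeeze `S` against the weighted Turán bound.
  have hS1 : S = 1 - 1 / (r : ℝ) := by
    refine le_antisymm hS ?_
    have : 2 * m * (1 - 1 / (r : ℝ)) ≤ 2 * m * S := by linarith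
    exact le_of_mul_le_mul_left this (by linarith)
  have hqeq : q ^ 2 = (1 - 1 / (r : ℝ)) * (2 * m) := by
    refine le_antisymm ?_ hq
    rw [← hS1]; linarith
  set c := q / (2 * m) with hc
  have hc0 : 0 < c := by positivity
  -- For `c` the mean of x_u x_v over edges, this sum is the defect in Cauchy–Schwarz; its vanishing
  -- makes x_u x_v constant on edges.
  have hsq0 : ∑ u, ∑ v, (if G.Adj u v then (x u * x v - c) ^ 2 else 0) = 0 := by
    rw [sum_adj_mul_sub_sq, hm, ← hqdef, ← hSdef, hS1]
    have e1 : 2 * c * q = 2 * (q ^ 2 / (2 * m)) := by rw [hc]; ring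
    have e2 : c ^ 2 * (2 * m) = q ^ 2 / (2 * m) := by rw [hc]; field_simp
    rw [e1, e2, hqeq]
    field_simp
    ring
  have hedge : ∀ u v, G.Adj u v → x u * x v = c := by
    intro u v huv
    have hnn : ∀ u v, 0 ≤ (if G.Adj u v then (x u * x v - c) ^ 2 else 0) := fun u v => by
      split_ifs <;> positivity
    have h1 := (Finset.sum_eq_zero_iff_of_nonneg fun u _ =>
        Finset.sum_nonneg fun v _ => hnn u v).1 hsq0 u (by simp)
    have h2 := (Finset.sum_eq_zero_iff_of_nonneg fun v _ => hnn u v).1 h1 v (by simp)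
    rw [if_pos huv] at h2
    have := pow_eq_zero_iff (two_ne_zero) |>.1 h2
    linarith
  have hpos : ∀ u v, G.Adj u v → 0 < x u := by
    intro u v huv
    refine lt_of_le_of_ne (hx u) fun h0 => ?_
    have := hedge u v huv
    rw [← h0, zero_mul] at this
    linarith
  obtain ⟨f, hf, hY⟩ := hSeq hS1
  -- Vertices with x = 0 are isolated, since x_u x_v = c > 0 on edges; the colour classes are
  -- trimmed of them.
  set W : Fin r → Finset V := fun i => {v | f v = i ∧ 0 < x v} with hWdef
  have hmem : ∀ i v, v ∈ W i ↔ f v = i ∧ 0 < x v := fun i v => by simp [hWdef]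
  have hWsum : ∀ i, ∑ v ∈ W i, x v ^ 2 = 1 / (r : ℝ) := by
    intro i
    rw [← hY i]
    refine Finset.sum_subset (fun v hv => by simpa using ((hmem i v).1 hv).1) fun v hv hv' => ?_
    have h1 : f v = i := by simpa using hv
    have h2 : ¬ 0 < x v := fun h2 => hv' ((hmem i v).2 ⟨h1, h2⟩)
    rw [le_antisymm (not_lt.1 h2) (hx v)]
    simp
  have hWne : ∀ i, (W i).Nonempty := by
    intro i
    rw [Finset.nonempty_iff_ne_empty]
    intro h0
    have := hWsum i
    rw [h0, Finset.sum_empty] at this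
    have : 0 < 1 / (r : ℝ) := by positivity
    linarith
  have hWd : Pairwise (Function.onFun Disjoint W) := by
    intro i j hij
    refine Finset.disjoint_left.2 fun v hi hj => hij ?_
    rw [← ((hmem i v).1 hi).1, ← ((hmem j v).1 hj).1]
  have hG : G = completePartite W := by
    ext u v
    constructor
    · intro huv
      have hu := hpos u v huv
      have hv := hpos v u huv.symm
      exact ⟨huv.ne, f u, f v, (hf u v (by positivity) (by positivity)).1 huv,
        (hmem _ _).2 ⟨rfl, hu⟩, (hmem _ _).2 ⟨rfl, hv⟩⟩
    · rintro ⟨-, i, j, hij, hu, hv⟩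
      obtain ⟨rfl, hu⟩ := (hmem _ _).1 hu
      obtain ⟨rfl, hv⟩ := (hmem _ _).1 hv
      exact (hf u v (by positivity) (by positivity)).2 hij
  refine ⟨hqeq, ⟨W, hWne, hWd, hG⟩, fun h3 => ⟨W, hWne, hWd, hG, ?_⟩⟩
  have hreg := regularOn_completePartite h3 hWd hWne (x := x) (c := c)
    (fun i v hv => ((hmem i v).1 hv).2) (fun u v huv => hedge u v (hG ▸ huv)) hWsum
  rwa [hG]

/-- Lower bound on the spectral radius of the extremal graphs. -/
lemma le_lam_sq {V : Type*} [Fintype V] {r m : ℕ} (hr : 2 ≤ r) {W : Fin r → Finset V}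
    (hne : ∀ i, (W i).Nonempty) (hW : Pairwise (Function.onFun Disjoint W))
    (hreg : 3 ≤ r → RegularOn (completePartite W) (⋃ i, (W i : Set V)))
    (hm : (completePartite W).edgeSet.ncard = m) :
    (1 - 1 / (r : ℝ)) * (2 * m) ≤ lam (completePartite W) ^ 2 := by
  have hr0 : (2 : ℝ) ≤ r := by exact_mod_cast hr
  obtain ⟨P, hP0, hP⟩ := exists_card_mul_card_eq hr hW hne hreg
  have h1 := le_lam_completePartite hr hW hne hP
  have h2 := two_mul_ncard_edgeSet_completePartite hW hP
  rw [hm] at h2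
  rw [h2]
  have h3 : (1 - 1 / (r : ℝ)) * (r * (r - 1) * P) = ((r - 1) * √P) ^ 2 := by
    rw [mul_pow, Real.sq_sqrt hP0.le]
    field_simp
  rw [h3]
  exact pow_le_pow_left₀ (mul_nonneg (by linarith) (Real.sqrt_nonneg _)) h1 2

end EdgeSpectral

/-! ### The main theorem. -/

theorem theorem3p1 (t r : ℕ) (ht : 2 ≤ t) (hr : 2 ≤ r) :
    ∃ (ε : ℝ) (n₀ : ℕ), 0 < ε ∧
      ∀ (V : Type*) [Fintype V] (G : SimpleGraph V) (m : ℕ) (U : Fin r → Finset V),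
        (EdgeSpectral.blowupPlus r t).Free G →
        G.edgeSet.ncard = m →
        Pairwise (Function.onFun Disjoint U) →
        (∀ i, n₀ ≤ (U i).card) →
        (3 ≤ r → EdgeSpectral.RegularOn (EdgeSpectral.completePartite U)
          (⋃ i, (U i : Set V))) →
        (EdgeSpectral.editDist G (EdgeSpectral.completePartite U) : ℝ) ≤ ε * m →
        EdgeSpectral.lam G ^ 2 ≤ (1 - 1 / (r : ℝ)) * (2 * m) ∧
        (r = 2 → (EdgeSpectral.lam G ^ 2 = (1 - 1 / (r : ℝ)) * (2 * m) ↔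
          EdgeSpectral.IsCompletePartite 2 G)) ∧
        (3 ≤ r → (EdgeSpectral.lam G ^ 2 = (1 - 1 / (r : ℝ)) * (2 * m) ↔
          EdgeSpectral.IsRegularCompletePartite r G)) := by
  classical
  have hr0 : (2 : ℝ) ≤ r := by exact_mod_cast hr
  have ht0 : (2 : ℝ) ≤ t := by exact_mod_cast ht
  obtain ⟨β, hβ⟩ : ∃ β : ℝ, β = 1 / (100 * r * (r * t)) := ⟨_, rfl⟩
  have hβ0 : 0 < β := by rw [hβ]; positivity
  have hβeq : 100 * r * (r * t) * β = 1 := by rw [hβ]; field_simp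
  have hβ1 : β ≤ 1 := by
    have h4 : (4 : ℝ) ≤ r * t := by nlinarith
    rw [hβ, div_le_one (by positivity)]
    nlinarith
  -- With ρ = β²/5 and κ = ρ²/8 this is ε = κ², as `nearPartite_of_le_sq` requires.
  refine ⟨((β ^ 2 / 5) ^ 2 / 8) ^ 2, ⌈2 / β⌉₊, by positivity, ?_⟩
  intro V _ G m U hfree hm hU hcard hreg hedit
  have hcard' : ∀ i, 2 / β ≤ ((U i).card : ℝ) := fun i =>
    (Nat.le_ceil _).trans (by exact_mod_cast hcard i)
  have hne : ∀ i, (U i).Nonempty := fun i => by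
    have : (0 : ℝ) < (U i).card := lt_of_lt_of_le (by positivity) (hcard' i)
    exact Finset.card_pos.1 (by exact_mod_cast this)
  obtain ⟨P, hP0, hP⟩ := EdgeSpectral.exists_card_mul_card_eq hr hU hne hreg
  -- With m = 0 the edit bound would force G = H, but H has edges.
  have hm0 : 0 < m := by
    rw [Nat.pos_iff_ne_zero]
    rintro rfl
    have h1 : EdgeSpectral.editDist G (EdgeSpectral.completePartite U) = 0 := by
      have : (EdgeSpectral.editDist G (EdgeSpectral.completePartite U) : ℝ) ≤ 0 := by
        simpa using hedit
      exact_mod_cast le_antisymm this (by positivity)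
    rw [EdgeSpectral.editDist, Set.ncard_eq_zero, ← Set.bot_eq_empty, symmDiff_eq_bot] at h1
    have h2 := EdgeSpectral.two_mul_ncard_edgeSet_completePartite hU hP
    rw [← h1, hm] at h2
    have h3 : 0 < r * (r - 1) * P := mul_pos (mul_pos (by linarith) (by linarith)) hP0
    simp only [Nat.cast_zero, mul_zero] at h2
    linarith
  have : Nonempty V := ⟨(hne ⟨0, by omega⟩).choose⟩
  -- Assuming only the weak reverse inequality lets one argument serve both the upper bound, by
  -- contradiction, and the description of equality.
  have key : (1 - 1 / (r : ℝ)) * (2 * m) ≤ EdgeSpectral.lam G ^ 2 →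
      EdgeSpectral.lam G ^ 2 = (1 - 1 / (r : ℝ)) * (2 * m) ∧ EdgeSpectral.IsCompletePartite r G ∧
        (3 ≤ r → EdgeSpectral.IsRegularCompletePartite r G) := by
    intro hle
    obtain ⟨x, hx, hx1, hlam⟩ := EdgeSpectral.exists_unit_vector_lam_le G
    have hlam2 := pow_le_pow_left₀ (EdgeSpectral.lam_nonneg G) hlam 2
    have hnear := EdgeSpectral.nearPartite_of_le_sq hr hm hU hβ0 hβ1 (ρ := β ^ 2 / 5)
      (κ := (β ^ 2 / 5) ^ 2 / 8) (by ring) (by ring) hcard' hP hedit hx hx1 (hle.trans hlam2)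
    obtain ⟨h1, h2⟩ := hnear.eq_and_isCompletePartite hr ht hβeq hfree hm hm0 hx
      (hle.trans hlam2)
    exact ⟨le_antisymm (h1 ▸ hlam2) hle, h2⟩
  have hle : EdgeSpectral.lam G ^ 2 ≤ (1 - 1 / (r : ℝ)) * (2 * m) := by
    by_contra! hlt
    exact hlt.ne' (key hlt.le).1
  refine ⟨hle, ?_, fun h3 => ⟨fun heq => (key heq.ge).2.2 h3, ?_⟩⟩
  · rintro rfl
    refine ⟨fun heq => (key heq.ge).2.1, ?_⟩
    rintro ⟨W, hWne, hW, rfl⟩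
    exact le_antisymm hle (EdgeSpectral.le_lam_sq hr hWne hW (by omega) hm)
  · rintro ⟨W, hWne, hW, rfl, hWreg⟩
    exact le_antisymm hle (EdgeSpectral.le_lam_sq hr hWne hW (fun _ => hWreg) hm)
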